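/- Let $\Gamma$ be a countable group. A shift system over a finite alphabet $\mathtt A$ is $(\mathtt A^\Gamma,\mu,T)$, where $T^g x(h)=x(g^{-1}h)$ and $\mu$ is a $T$-invariant Borel probability measure; $\mathrm{Prob}(\mathtt A^\Gamma)$ carries the weak* topology. Let $\Sigma=(\sigma_n)_n$ be a sofic approximation by homomorphisms: $V_n$ are non-empty finite sets, $\sigma_n:\Gamma\to\mathrm{Sym}(V_n)$ are homomorphisms, and $|V_n|^{-1}|\{v:\sigma_n(g)v=v\}|\to0$ for every $g\ne 1$. If $\Gamma$ is finite, assume also that $|V_n|\to\infty$ (this is automatic if $\Gamma$ is infinite). For $\mathbf x\in\mathtt A^{V_n}$ let $P_{\mathbf x}^{\sigma_n}=|V_n|^{-1}\sum_{v\in V_n}\delta_{\Pi_v(\mathbf x)}$, where $\Pi_v(\mathbf x)(g)=\mathbf x(\sigma_n(g^{-1})v)$. For $\mathcal O\subseteq\mathrm{Prob}(\mathtt A^\Gamma)$ let $\Omega(\sigma_n,\mathcal O)=\{\mathbf x\in\mathtt A^{V_n}:P_{\mathbf x}^{\sigma_n}\in\mathcal O\}$. The shift system has microstates along $\Sigma$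 if for every neighbourhood $\mathcal O$ of $\mu$ the set $\Omega(\sigma_n,\mathcal O)$ is non-empty for all sufficiently large $n$; a general probability-preserving $\Gamma$-system has microstates along $\Sigma$ if each of its finite-alphabet shift-system factors does. Write $d(\mathbf x,\mathbf y)=|V_n|^{-1}|\{v:\mathbf x(v)\ne\mathbf y(v)\}|$. The shift system has totally shattered microstate spaces along $\Sigma$ if it has microstates along $\Sigma$ and there is $\delta>0$ such that for every $\varepsilon>0$ there are a neighbourhood $\mathcal O$ of $\mu$ and $n_0$ such that for all $n\ge n_0$ and $\mathbf x,\mathbf y\in\Omega(\sigma_n,\mathcal O)$ either $d(\mathbf x,\mathbf y)\ge\delta$ or $d(\mathbf x,\mathbf y)<\varepsilon$. All probability spaces are standard and factor maps are measurable, measure-preserving and almost everywhere equivariant. A Bernoulli shift is $(\mathtt K^\Gamma,\kappa^\Gamma,T)$ with $(\mathtt K,\kappa)$ a standard probability space; it is trivial if $\kappa$ is a point mass. A system is a direct factor of another if it is the image of a factor map $\pi$ for which there is a factor map $\xi$ to a third system such that $(\pi,\xi)$ is an isomorphism onto the product system. A system $(X,\mu,T)$ is weakly contained in $(Y,\nu,S)$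 if for all measurable $C_1,\dots,C_m\subseteq X$, finite $F\subseteq\Gamma$ and $\varepsilon>0$ there are measurable $D_1,\dots,D_m\subseteq Y$ with $|\mu(T^gC_i\cap C_j)-\nu(S^gD_i\cap D_j)|<\varepsilon$ for all $g\in F$ and all $i,j$. For measurable $\phi:X\to\mathtt A$ on a system $(X,\mu,T)$ put $\phi^\Gamma(x)(g)=\phi(T^{g^{-1}}x)$. Suppose that $(\mathtt A^\Gamma,\mu,T)$ has totally shattered microstate spaces along $\Sigma$. Then: (0) For every $\varepsilon>0$ there is a neighbourhood $\mathcal O$ of $\mu$ such that, for every shift system $(\mathtt B^\Gamma,\nu,T)$ over a finite alphabet that has microstates along $\Sigma$, every Bernoulli shift $(\mathtt K^\Gamma,\kappa^\Gamma,T)$ and every measurable $\phi:\mathtt B^\Gamma\times\mathtt K^\Gamma\to\mathtt A$, if $\phi^\Gamma_*(\nu\times\kappa^\Gamma)\in\mathcal O$ then $(\nu\times\kappa^\Gamma\times\kappa^\Gamma)\{(y,z,z'):\phi(y,z)\ne\phi(y,z')\}<\varepsilon$. (1) If $(Y,\theta,S)$ is a probability-preserving $\Gamma$-system that has microstates along $\Sigma$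 and $(\mathtt K^\Gamma,\kappa^\Gamma,T)$ is a Bernoulli shift, then every factor map $\Phi:(Y\times\mathtt K^\Gamma,\theta\times\kappa^\Gamma,S\times T)\to(\mathtt A^\Gamma,\mu,T)$ factorizes through the coordinate projection to $Y$: there is a factor map $\Psi:(Y,\theta,S)\to(\mathtt A^\Gamma,\mu,T)$ with $\Phi(y,z)=\Psi(y)$ for almost every $(y,z)$. (2) Every direct factor of $(\mathtt A^\Gamma,\mu,T)$ that is a Bernoulli shift is trivial. (3) If $(\mathtt A^\Gamma,\mu,T)$ is weakly contained in a Bernoulli shift, then $\mu=\delta_{(\dots,a,a,\dots)}$ for some $a\in\mathtt A$. -/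

import Mathlib

open MeasureTheory Filter Topology
open scoped ENNReal

namespace SoficShift

/-! ### Probability-preserving systems -/

/-- A probability-preserving `Γ`-system structure on `(X, μ)`: a homomorphism from `Γ` to the
group of automorphisms of `(X, μ)`, where maps that agree almost everywhere are identified. -/
structure PMPAction (Γ : Type*) [Group Γ] {X : Type*} [MeasurableSpace X] (μ : Measure X) where
  act : Γ → X → X
  measurePreserving : ∀ g, MeasurePreserving (act g) μ μ
  act_one : act 1 =ᵐ[μ] id
  act_mul : ∀ g h, act (g * h) =ᵐ[μ] act g ∘ act h

/-- The diagonal action on a product system. -/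
def PMPAction.prod {Γ : Type*} [Group Γ]
    {X : Type*} [MeasurableSpace X] {μ : Measure X} [IsProbabilityMeasure μ]
    {Y : Type*} [MeasurableSpace Y] {ν : Measure Y} [IsProbabilityMeasure ν]
    (T : PMPAction Γ μ) (S : PMPAction Γ ν) : PMPAction Γ (μ.prod ν) where
  act g p := (T.act g p.1, S.act g p.2)
  measurePreserving g := (T.measurePreserving g).prod (S.measurePreserving g)
  act_one := by
    filter_upwards [Measure.quasiMeasurePreserving_fst.ae T.act_one,
      Measure.quasiMeasurePreserving_snd.ae S.act_one] with p h₁ h₂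
    simp [h₁, h₂]
  act_mul g h := by
    filter_upwards [Measure.quasiMeasurePreserving_fst.ae (T.act_mul g h),
      Measure.quasiMeasurePreserving_snd.ae (S.act_mul g h)] with p h₁ h₂
    simp [h₁, h₂]

/-- `Φ` is a factor map from `(X, μ, T)` to `(Y, ν, S)`. -/
structure IsFactorMap {Γ : Type*} [Group Γ]
    {X : Type*} [MeasurableSpace X] {μ : Measure X}
    {Y : Type*} [MeasurableSpace Y] {ν : Measure Y}
    (T : PMPAction Γ μ) (S : PMPAction Γ ν) (Φ : X → Y) : Prop where
  aemeasurable : AEMeasurable Φ μ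
  map_eq : μ.map Φ = ν
  equivariant : ∀ g, ∀ᵐ x ∂μ, Φ (T.act g x) = S.act g (Φ x)

/-- `Φ` is an isomorphism of systems: a factor map which is invertible up to null sets. -/
def IsIsomorphism {Γ : Type*} [Group Γ]
    {X : Type*} [MeasurableSpace X] {μ : Measure X}
    {Y : Type*} [MeasurableSpace Y] {ν : Measure Y}
    (T : PMPAction Γ μ) (S : PMPAction Γ ν) (Φ : X → Y) : Prop :=
  IsFactorMap T S Φ ∧ ∃ Ψ : Y → X, IsFactorMap S T Ψ ∧
    (∀ᵐ x ∂μ, Ψ (Φ x) = x) ∧ (∀ᵐ y ∂ν, Φ (Ψ y) = y)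

/-- `(Z, ζ, R)` is a direct factor of `(X, μ, T)`: there are a factor map `π` to it and another
factor map `ξ` to some system on a standard probability space such that `(π, ξ)` is an isomorphism
to the product system. -/
def IsDirectFactor.{w, u, v, t} {Γ : Type t} [Group Γ]
    {Z : Type v} [MeasurableSpace Z] {ζ : Measure Z} [IsProbabilityMeasure ζ]
    {X : Type u} [MeasurableSpace X] {μ : Measure X}
    (R : PMPAction Γ ζ) (T : PMPAction Γ μ) : Prop :=
  ∃ (Y : Type w) (_ : MeasurableSpace Y) (_ : StandardBorelSpace Y)
    (θ : Measure Y) (_ : IsProbabilityMeasure θ) (S : PMPAction Γ θ) (π : X → Z) (ξ : X → Y),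
    IsFactorMap T R π ∧ IsFactorMap T S ξ ∧
      IsIsomorphism T (R.prod S) (fun x => (π x, ξ x))

/-- `(X, μ, T)` is weakly contained in `(Y, ν, S)`. Here `(T.act g⁻¹) ⁻¹' C` is the translate of
the set `C` by `g`, up to a null set. -/
def IsWeaklyContained {Γ : Type*} [Group Γ]
    {X : Type*} [MeasurableSpace X] {μ : Measure X}
    {Y : Type*} [MeasurableSpace Y] {ν : Measure Y}
    (T : PMPAction Γ μ) (S : PMPAction Γ ν) : Prop :=
  ∀ (m : ℕ) (C : Fin m → Set X), (∀ i, MeasurableSet (C i)) →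
    ∀ (F : Finset Γ) (ε : ℝ), 0 < ε →
      ∃ D : Fin m → Set Y, (∀ i, MeasurableSet (D i)) ∧
        ∀ g ∈ F, ∀ i j,
          |μ.real (T.act g⁻¹ ⁻¹' C i ∩ C j) - ν.real (S.act g⁻¹ ⁻¹' D i ∩ D j)| < ε

/-! ### Shift systems and Bernoulli shifts -/

/-- The shift `(T^g x)(h) = x(g⁻¹ h)`. -/
def shift {Γ : Type*} [Group Γ] {A : Type*} (g : Γ) (x : Γ → A) : Γ → A :=
  fun h => x (g⁻¹ * h)

theorem measurable_shift {Γ : Type*} [Group Γ] {A : Type*} [MeasurableSpace A] (g : Γ) :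
    Measurable (shift g : (Γ → A) → Γ → A) :=
  measurable_pi_lambda _ fun _ => measurable_pi_apply _

/-- Invariance of a measure under the shift action. -/
def IsShiftInvariant {Γ : Type*} [Group Γ] {A : Type*} [MeasurableSpace A]
    (μ : Measure (Γ → A)) : Prop :=
  ∀ g : Γ, μ.map (shift g) = μ

/-- The shift system `(A^Γ, μ, T)`. -/
def shiftSystem {Γ : Type*} [Group Γ] {A : Type*} [MeasurableSpace A]
    {μ : Measure (Γ → A)} (hμ : IsShiftInvariant μ) : PMPAction Γ μ where
  act := shift
  measurePreserving g := ⟨measurable_shift g, hμ g⟩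
  act_one := by
    refine Eventually.of_forall fun x => ?_
    funext h
    simp [shift]
  act_mul g h := by
    refine Eventually.of_forall fun x => ?_
    funext k
    simp [shift, mul_assoc]

/-- The product measure `κ^Γ`. -/
noncomputable def bernoulliMeasure (Γ : Type*) {K : Type*} [MeasurableSpace K]
    (κ : Measure K) [IsProbabilityMeasure κ] : Measure (Γ → K) :=
  Measure.infinitePi fun _ : Γ => κ

instance (Γ : Type*) {K : Type*} [MeasurableSpace K] (κ : Measure K) [IsProbabilityMeasure κ] :
    IsProbabilityMeasure (bernoulliMeasure Γ κ) := by
  unfold bernoulliMeasure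
  infer_instance

theorem isShiftInvariant_bernoulliMeasure (Γ : Type*) [Group Γ] {K : Type*} [MeasurableSpace K]
    (κ : Measure K) [IsProbabilityMeasure κ] : IsShiftInvariant (bernoulliMeasure Γ κ) := by
  intro g
  have h := Measure.infinitePi_map_piCongrLeft (fun _ : Γ => κ) (Equiv.mulLeft g)
  have e : (MeasurableEquiv.piCongrLeft (fun _ : Γ => K) (Equiv.mulLeft g) : (Γ → K) → Γ → K)
      = shift g := by
    funext x k
    obtain ⟨k, rfl⟩ := (Equiv.mulLeft g).surjective k
    rw [MeasurableEquiv.coe_piCongrLeft, Equiv.piCongrLeft_apply_apply]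
    simp [shift]
  rw [← e]
  exact h

/-- The Bernoulli shift `(K^Γ, κ^Γ, T)`. -/
noncomputable def bernoulliShift (Γ : Type*) [Group Γ] {K : Type*} [MeasurableSpace K]
    (κ : Measure K) [IsProbabilityMeasure κ] : PMPAction Γ (bernoulliMeasure Γ κ) :=
  shiftSystem (isShiftInvariant_bernoulliMeasure Γ κ)

/-- The equivariant map `φ^Γ : X → A^Γ` induced by `φ : X → A`. -/
def equivariantMap {Γ : Type*} [Group Γ] {X : Type*} [MeasurableSpace X] {μ : Measure X}
    (T : PMPAction Γ μ) {A : Type*} (φ : X → A) : X → Γ → A :=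
  fun x g => φ (T.act g⁻¹ x)

theorem measurable_equivariantMap {Γ : Type*} [Group Γ] {X : Type*} [MeasurableSpace X]
    {μ : Measure X} (T : PMPAction Γ μ) {A : Type*} [MeasurableSpace A] {φ : X → A}
    (hφ : Measurable φ) : Measurable (equivariantMap T φ) :=
  measurable_pi_lambda _ fun g => hφ.comp (T.measurePreserving g⁻¹).measurable

/-- The push-forward of `μ` under `φ^Γ`. -/
noncomputable def equivariantLaw {Γ : Type*} [Group Γ] {X : Type*} [MeasurableSpace X]
    {μ : Measure X} [IsProbabilityMeasure μ] (T : PMPAction Γ μ) {A : Type*} [MeasurableSpace A]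
    {φ : X → A} (hφ : Measurable φ) : ProbabilityMeasure (Γ → A) :=
  ⟨μ.map (equivariantMap T φ),
    Measure.isProbabilityMeasure_map (measurable_equivariantMap T hφ).aemeasurable⟩

/-! ### Sofic approximations and microstates -/

/-- The sequence of maps `σ n : Γ → Sym(V n)` is a sofic approximation: it is asymptotically
homomorphic and asymptotically free. -/
def IsSoficApproximation {Γ : Type*} [Group Γ] {V : ℕ → Type*} [∀ n, Fintype (V n)]
    (σ : ∀ n, Γ → Equiv.Perm (V n)) : Prop :=
  (∀ g h : Γ, Tendsto (fun n =>
      (Set.ncard {v : V n | σ n (g * h) v = σ n g (σ n h v)} : ℝ) / Fintype.card (V n))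
      atTop (𝓝 1)) ∧
  (∀ g : Γ, g ≠ 1 → Tendsto (fun n =>
      (Set.ncard {v : V n | σ n g v = v} : ℝ) / Fintype.card (V n)) atTop (𝓝 0))

/-- The pullback name `Π_v^σ(x) ∈ A^Γ` of `x : V → A` at `v`. -/
def pullbackName {Γ : Type*} [Group Γ] {V A : Type*} (σ : Γ → Equiv.Perm V) (x : V → A) (v : V) :
    Γ → A :=
  fun g => x (σ g⁻¹ v)

/-- The empirical measure `P_x^σ` of `x : V → A`. -/
noncomputable def empiricalMeasure {Γ : Type*} [Group Γ] {V A : Type*} [Fintype V] [Nonempty V]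
    [MeasurableSpace A] (σ : Γ → Equiv.Perm V) (x : V → A) : ProbabilityMeasure (Γ → A) :=
  ⟨(Fintype.card V : ℝ≥0∞)⁻¹ • ∑ v, Measure.dirac (pullbackName σ x v), ⟨by
    simp [ENNReal.inv_mul_cancel]⟩⟩

/-- The set `Ω(σ, O)` of `(O, σ)`-microstates. -/
def microstates {Γ : Type*} [Group Γ] {V A : Type*} [Fintype V] [Nonempty V]
    [MeasurableSpace A] (σ : Γ → Equiv.Perm V) (O : Set (ProbabilityMeasure (Γ → A))) :
    Set (V → A) :=
  {x | empiricalMeasure σ x ∈ O}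

/-- The normalized Hamming distance. -/
noncomputable def normHamming {V A : Type*} [Fintype V] (x y : V → A) : ℝ :=
  (Set.ncard {v | x v ≠ y v} : ℝ) / Fintype.card V

/-- The shift system over the finite alphabet `A` with invariant measure `μ` has microstates along
`σ`. -/
def HasMicrostates {Γ : Type*} [Group Γ] [Countable Γ] {V : ℕ → Type*} [∀ n, Fintype (V n)]
    [∀ n, Nonempty (V n)] (σ : ∀ n, Γ → Equiv.Perm (V n))
    {A : Type*} [Finite A] [TopologicalSpace A] [DiscreteTopology A] [MeasurableSpace A]
    [BorelSpace A] (μ : ProbabilityMeasure (Γ → A)) : Prop :=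
  ∀ O ∈ 𝓝 μ, ∀ᶠ n in atTop, (microstates (σ n) O).Nonempty

/-- An arbitrary probability-preserving system has microstates along `σ` if each of its
finite-alphabet shift-system factors does. -/
def SystemHasMicrostates {Γ : Type*} [Group Γ] [Countable Γ] {V : ℕ → Type*}
    [∀ n, Fintype (V n)] [∀ n, Nonempty (V n)] (σ : ∀ n, Γ → Equiv.Perm (V n))
    {Y : Type*} [MeasurableSpace Y] {θ : Measure Y} (S : PMPAction Γ θ) : Prop :=
  ∀ (B : Type) [Finite B] [TopologicalSpace B] [DiscreteTopology B] [MeasurableSpace B]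
    [BorelSpace B] (ν : ProbabilityMeasure (Γ → B))
    (hν : IsShiftInvariant (ν : Measure (Γ → B))) (Φ : Y → Γ → B),
    IsFactorMap S (shiftSystem hν) Φ → HasMicrostates σ ν

/-- The shift system over the finite alphabet `A` with invariant measure `μ` has totally shattered
microstate spaces along `σ`. -/
def HasTotallyShatteredMicrostates {Γ : Type*} [Group Γ] [Countable Γ] {V : ℕ → Type*}
    [∀ n, Fintype (V n)] [∀ n, Nonempty (V n)] (σ : ∀ n, Γ → Equiv.Perm (V n))
    {A : Type*} [Finite A] [TopologicalSpace A] [DiscreteTopology A] [MeasurableSpace A]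
    [BorelSpace A] (μ : ProbabilityMeasure (Γ → A)) : Prop :=
  HasMicrostates σ μ ∧
  ∃ δ : ℝ, 0 < δ ∧ ∀ ε : ℝ, 0 < ε → ∃ O ∈ 𝓝 μ, ∃ n₀ : ℕ, ∀ n ≥ n₀,
    ∀ x ∈ microstates (σ n) O, ∀ y ∈ microstates (σ n) O,
      δ ≤ normHamming x y ∨ normHamming x y < ε

end SoficShift

open SoficShift

universe uΓ uV uA uB uK uY

/-!
The random labelling of `V n` with independent entries of law `κ` extends a model of a system to a
model of its product with the Bernoulli shift over `κ`, with high probability: the frequency of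
occurrences of a local pattern has variance of order `1 / |V n|` by independence, and nearly the
right mean because the action of `Γ` on `V n` is asymptotically free.

Let now `φ` be a map to `A` on the product of a system with a Bernoulli shift, whose equivariant
extension has law near `μ`. Take independent points `z` and `z'` of the Bernoulli shift and an
independent clock `u : Γ → Fin N`, and replace `z` by `z'` at the coordinates where the clock shows
a value below `j`, for `j = 0, …, N`. The points of the resulting path from `z` to `z'` all have the
same law, and for a fine clock consecutive points seldom give different values of `φ`. A joint
model of the path thus consists of microstates `x₀, …, x_N` for `μ`, consecutive ones of which are
close. By total shattering the distance from `x₀` to `xⱼ` cannot jump from below `ε` to above `δ`,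
so it stays below `ε`. This means that `φ` nearly ignores the Bernoulli coordinate.

A factor map with law exactly `μ` therefore ignores it altogether. If a Bernoulli shift is a direct
factor of the shattered system, then by inverting the isomorphism it becomes a function of the
complementary factor, of which it is independent, so it is trivial. Under weak containment in a
Bernoulli shift, `φ` may be taken on the Bernoulli shift alone, where ignoring the Bernoulli
coordinate means being constant.
-/

namespace SoficShift

/-! ### Frequencies and local events -/

/-- The proportion of points of the finite set `V` that lie in `P`, that is, the probability of `P`
under the uniform distribution. -/
noncomputable def freq {V : Type*} [Fintype V] (P : Set V) : ℝ :=
  (P.ncard : ℝ) / Fintype.card V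

section Freq

variable {V : Type*} [Fintype V]

theorem freq_nonneg (P : Set V) : 0 ≤ freq P := by
  unfold freq; positivity

theorem freq_mono {P Q : Set V} (h : P ⊆ Q) : freq P ≤ freq Q := by
  unfold freq
  gcongr
  exact Q.toFinite

theorem freq_union_le (P Q : Set V) : freq (P ∪ Q) ≤ freq P + freq Q := by
  unfold freq
  rw [← add_div]
  gcongr
  exact_mod_cast Set.ncard_union_le P Q

theorem freq_biUnion_le {ι : Type*} (s : Finset ι) (P : ι → Set V) :
    freq (⋃ i ∈ s, P i) ≤ ∑ i ∈ s, freq (P i) := by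
  classical
  induction s using Finset.induction_on with
  | empty => simp [freq]
  | insert a s ha ih =>
    rw [Finset.set_biUnion_insert, Finset.sum_insert ha]
    exact (freq_union_le _ _).trans (by gcongr)

theorem freq_univ [Nonempty V] : freq (Set.univ : Set V) = 1 := by
  unfold freq
  rw [Set.ncard_univ, Nat.card_eq_fintype_card]
  exact div_self (by positivity)

end Freq

theorem normHamming_triangle {V A : Type*} [Fintype V] (x y z : V → A) :
    normHamming x z ≤ normHamming x y + normHamming y z := by
  have h : {v | x v ≠ z v} ⊆ {v | x v ≠ y v} ∪ {v | y v ≠ z v} := fun v hv =>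
    (Ne.ne_or_ne (y v) hv).imp_right Ne.symm
  exact (freq_mono h).trans (freq_union_le _ _)

/-- The event `E` in `A^Γ` depends only on the coordinates in the finite set `W`. -/
def IsLocal {Γ A : Type*} (W : Finset Γ) (E : Set (Γ → A)) : Prop :=
  DependsOn (· ∈ E) (W : Set Γ)

section IsLocal

variable {Γ A : Type*} {W W' : Finset Γ} {E : Set (Γ → A)}

theorem IsLocal.mem_iff (h : IsLocal W E) {a b : Γ → A} (hab : ∀ g ∈ W, a g = b g) :
    a ∈ E ↔ b ∈ E :=
  (h hab).to_iff

theorem isLocal_of_mem_imp (h : ∀ a b : Γ → A, (∀ g ∈ W, a g = b g) → a ∈ E → b ∈ E) :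
    IsLocal W E :=
  fun a b hab => propext ⟨h a b hab, h b a fun g hg => (hab g hg).symm⟩

theorem IsLocal.mono (h : IsLocal W E) (hW : W ⊆ W') : IsLocal W' E :=
  DependsOn.mono (Finset.coe_subset.2 hW) h

theorem IsLocal.compl (h : IsLocal W E) : IsLocal W Eᶜ :=
  isLocal_of_mem_imp fun _ _ hab => (not_congr (h.mem_iff hab)).1

theorem isLocal_cylinder (W : Finset Γ) (P : Set (W → A)) : IsLocal W (cylinder W P) :=
  isLocal_of_mem_imp fun a b hab ha => by
    rwa [mem_cylinder, show W.restrict b = W.restrict a from funext fun g => (hab g g.2).symm]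

theorem IsLocal.eq_cylinder (h : IsLocal W E) : E = cylinder W (W.restrict '' E) := by
  refine Set.Subset.antisymm (Set.subset_preimage_image _ _) ?_
  rintro b ⟨a, ha, hab⟩
  exact (h.mem_iff fun g hg => congrFun hab ⟨g, hg⟩).1 ha

theorem IsLocal.isClopen [TopologicalSpace A] [DiscreteTopology A] (h : IsLocal W E) :
    IsClopen E := by
  rw [h.eq_cylinder]
  exact (isClopen_discrete _).preimage (by fun_prop)

theorem IsLocal.measurableSet [Finite A] [MeasurableSpace A] [MeasurableSingletonClass A]
    (h : IsLocal W E) : MeasurableSet E := by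
  rw [h.eq_cylinder]
  exact (Set.toFinite _).measurableSet.cylinder W

theorem isLocal_setOf_forall_eq (W : Finset Γ) (p : W → A) :
    IsLocal W {a : Γ → A | ∀ g : W, a g = p g} :=
  isLocal_of_mem_imp fun _ _ hab ha g => (hab g g.2).symm.trans (ha g)

end IsLocal

/-! ### Neighbourhoods in the space of measures on a shift space -/

section Neighbourhoods

variable {Γ A : Type*} [Countable Γ] [Finite A] [TopologicalSpace A] [DiscreteTopology A]
  [MeasurableSpace A] [BorelSpace A] {μ : ProbabilityMeasure (Γ → A)}

theorem eventually_nhds_forall_isLocal (μ : ProbabilityMeasure (Γ → A)) (W : Finset Γ) {η : ℝ}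
    (hη : 0 < η) :
    ∀ᶠ ν : ProbabilityMeasure (Γ → A) in 𝓝 μ, ∀ E, IsLocal W E →
      |(ν : Measure (Γ → A)).real E - (μ : Measure (Γ → A)).real E| < η := by
  have h : ∀ P : Set (W → A), ∀ᶠ ν : ProbabilityMeasure (Γ → A) in 𝓝 μ,
      |(ν : Measure (Γ → A)).real (cylinder W P) -
        (μ : Measure (Γ → A)).real (cylinder W P)| < η := by
    intro P
    have := ProbabilityMeasure.tendsto_measure_of_isClopen_of_tendsto
      (tendsto_id (x := 𝓝 μ)) (isLocal_cylinder W P).isClopen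
    have := (NNReal.tendsto_coe.2 this).eventually (Metric.ball_mem_nhds _ hη)
    simpa [Metric.mem_ball, Real.dist_eq] using this
  filter_upwards [eventually_all.2 h] with ν hν E hE
  rw [hE.eq_cylinder]
  exact hν _

theorem tendsto_of_forall_isLocal {ι : Type*} {l : Filter ι} [l.IsCountablyGenerated]
    {ν : ι → ProbabilityMeasure (Γ → A)}
    (h : ∀ (W : Finset Γ) (E : Set (Γ → A)), IsLocal W E →
      Tendsto (fun i => (ν i : Measure (Γ → A)).real E) l (𝓝 ((μ : Measure (Γ → A)).real E))) :
    Tendsto ν l (𝓝 μ) := by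
  classical
  refine IsPiSystem.tendsto_probabilityMeasure_of_tendsto_of_mem isPiSystem_measurableCylinders
    (fun _ => MeasurableSet.of_mem_measurableCylinders) ?_ ?_
  · intro u hu a ha
    obtain ⟨I, t, ht, htu⟩ := isOpen_pi_iff.1 hu a ha
    have hE := isLocal_cylinder I {I.restrict a}
    refine ⟨_, cylinder_mem_measurableCylinders I _ (MeasurableSet.singleton (I.restrict a)),
      hE.isClopen.isOpen.mem_nhds rfl, fun b hb => htu fun g hg => ?_⟩
    have hbg : b g = a g := congrFun hb ⟨g, hg⟩
    exact hbg ▸ (ht g hg).2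
  · intro E hE
    obtain ⟨W, P, -, rfl⟩ := (mem_measurableCylinders E).1 hE
    exact NNReal.tendsto_coe.1 (h W _ (isLocal_cylinder W P))

theorem exists_local_nhds {O : Set (ProbabilityMeasure (Γ → A))} (hO : O ∈ 𝓝 μ) :
    ∃ (W : Finset Γ) (η : ℝ), 0 < η ∧ ∀ ν : ProbabilityMeasure (Γ → A),
      (∀ E, IsLocal W E →
        |(ν : Measure (Γ → A)).real E - (μ : Measure (Γ → A)).real E| < η) → ν ∈ O := by
  classical
  by_contra! hcon
  choose ν hν hνO using fun i : Finset Γ × ℕ => hcon i.1 (1 / (i.2 + 1)) (by positivity)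
  have hlim : Tendsto ν atTop (𝓝 μ) := by
    refine tendsto_of_forall_isLocal fun W E hE => tendsto_iff_dist_tendsto_zero.2 ?_
    refine squeeze_zero' (Eventually.of_forall fun _ => dist_nonneg) ?_
      (tendsto_one_div_add_atTop_nhds_zero_nat.comp (tendsto_snd.mono_left prod_atTop_atTop_eq.ge))
    filter_upwards [eventually_ge_atTop (W, 0)] with i hi
    exact (hν i E (hE.mono hi.1)).le
  obtain ⟨i, hi⟩ := (hlim.eventually hO).exists
  exact hνO i hi

end Neighbourhoods

theorem empiricalMeasure_real {Γ : Type*} [Group Γ] {V A : Type*} [Fintype V] [Nonempty V]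
    [MeasurableSpace A] (σ : Γ → Equiv.Perm V) (x : V → A) {E : Set (Γ → A)}
    (hE : MeasurableSet E) :
    (empiricalMeasure σ x : Measure (Γ → A)).real E = freq {v | pullbackName σ x v ∈ E} := by
  classical
  have h : (empiricalMeasure σ x : Measure (Γ → A)) =
      (Fintype.card V : ℝ≥0∞)⁻¹ • ∑ v, Measure.dirac (pullbackName σ x v) := rfl
  have hsum : ∑ v, E.indicator (1 : (Γ → A) → ℝ≥0∞) (pullbackName σ x v) =
      ({v | pullbackName σ x v ∈ E}.ncard : ℝ≥0∞) := by
    simp only [Set.indicator_apply, Pi.one_apply, Finset.sum_boole, Set.ncard_eq_toFinset_card',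
      Set.toFinset_ofPred]
  rw [h, measureReal_def, Measure.smul_apply, Measure.finsetSum_apply]
  simp_rw [Measure.dirac_apply' _ hE]
  rw [hsum, smul_eq_mul, ENNReal.toReal_mul, ENNReal.toReal_inv]
  simp [freq, div_eq_inv_mul]

/-! ### Models of finite-valued maps -/

/-- The labelling `x` of the finite set `V` is a model of the map `φ` on the system `S`: the names
of `x` have the same statistics on the window `W` as those of `φ`, up to an error `η`. -/
def IsModel {Γ V X A : Type*} [Group Γ] [Fintype V] (σ : Γ → Equiv.Perm V) [MeasurableSpace X]
    {θ : Measure X} (S : PMPAction Γ θ) (φ : X → A) (W : Finset Γ) (η : ℝ) (x : V → A) : Prop :=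
  ∀ E : Set (Γ → A), IsLocal W E →
    |freq {v | pullbackName σ x v ∈ E} - θ.real {y | equivariantMap S φ y ∈ E}| < η

/-- The map `φ` on the system `S` has models along `σ` for every window and every error. -/
def HasModels {Γ X A : Type*} [Group Γ] {V : ℕ → Type*} [∀ n, Fintype (V n)]
    (σ : ∀ n, Γ → Equiv.Perm (V n)) [MeasurableSpace X] {θ : Measure X} (S : PMPAction Γ θ)
    (φ : X → A) : Prop :=
  ∀ (W : Finset Γ) (η : ℝ), 0 < η → ∀ᶠ n in atTop, ∃ x, IsModel (σ n) S φ W η x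

/-- All finite-valued measurable maps on the system `S` have models along `σ`. The alphabets
`Fin m` represent all finite alphabets: see `AllModels.hasModels`. -/
def AllModels {Γ X : Type*} [Group Γ] {V : ℕ → Type*} [∀ n, Fintype (V n)]
    (σ : ∀ n, Γ → Equiv.Perm (V n)) [MeasurableSpace X] {θ : Measure X} (S : PMPAction Γ θ) :
    Prop :=
  ∀ (m : ℕ) (φ : X → Fin m), Measurable φ → HasModels σ S φ

section EquivariantMap

variable {Γ X A B : Type*} [Group Γ] [MeasurableSpace X] {θ : Measure X} {S : PMPAction Γ θ}
  {W : Finset Γ} {η : ℝ} {φ φ' : X → A}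

theorem abs_measureReal_sub_le_of_forall_notMem [IsFiniteMeasure θ] {P Q R : Set X}
    (h : ∀ x ∉ R, (x ∈ P ↔ x ∈ Q)) : |θ.real P - θ.real Q| ≤ θ.real R := by
  have hPQ : θ.real P ≤ θ.real Q + θ.real R := (measureReal_mono fun x hx =>
    or_iff_not_imp_right.2 fun hR => (h x hR).1 hx).trans (measureReal_union_le _ _)
  have hQP : θ.real Q ≤ θ.real P + θ.real R := (measureReal_mono fun x hx =>
    or_iff_not_imp_right.2 fun hR => (h x hR).2 hx).trans (measureReal_union_le _ _)
  exact abs_sub_le_iff.2 ⟨by linarith, by linarith⟩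

theorem measureReal_exists_equivariantMap_ne_le (S : PMPAction Γ θ)
    (hφ : NullMeasurableSet {x | φ x ≠ φ' x} θ) (W : Finset Γ) :
    θ.real {x | ∃ g ∈ W, equivariantMap S φ x g ≠ equivariantMap S φ' x g} ≤
      W.card * θ.real {x | φ x ≠ φ' x} := by
  have hunion : {x | ∃ g ∈ W, equivariantMap S φ x g ≠ equivariantMap S φ' x g} =
      ⋃ g ∈ W, S.act g⁻¹ ⁻¹' {x | φ x ≠ φ' x} := by
    ext x
    simp [equivariantMap]
  calc _ ≤ ∑ g ∈ W, θ.real (S.act g⁻¹ ⁻¹' {x | φ x ≠ φ' x}) :=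
        hunion ▸ measureReal_biUnion_finset_le _ _
    _ = ∑ _g ∈ W, θ.real {x | φ x ≠ φ' x} := Finset.sum_congr rfl fun g _ =>
        (S.measurePreserving g⁻¹).measureReal_preimage hφ
    _ = W.card * θ.real {x | φ x ≠ φ' x} := by simp

theorem abs_measureReal_equivariantMap_sub_le [IsFiniteMeasure θ] (S : PMPAction Γ θ)
    (hφ : NullMeasurableSet {x | φ x ≠ φ' x} θ) {E : Set (Γ → A)} (hE : IsLocal W E) :
    |θ.real {x | equivariantMap S φ x ∈ E} - θ.real {x | equivariantMap S φ' x ∈ E}| ≤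
      W.card * θ.real {x | φ x ≠ φ' x} := by
  refine (abs_measureReal_sub_le_of_forall_notMem fun x hx => ?_).trans
    (measureReal_exists_equivariantMap_ne_le S hφ W)
  refine hE.mem_iff fun g hg => ?_
  by_contra hne
  exact hx ⟨g, hg, hne⟩

theorem equivariantMap_ae_congr [Countable Γ] (S : PMPAction Γ θ) (h : φ =ᵐ[θ] φ') :
    equivariantMap S φ =ᵐ[θ] equivariantMap S φ' := by
  filter_upwards [ae_all_iff.2 fun g =>
    (S.measurePreserving g⁻¹).quasiMeasurePreserving.ae h] with x hx
  exact funext hx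

theorem ae_equivariantMap_act [Countable Γ] (S : PMPAction Γ θ) (φ : X → A) :
    ∀ᵐ x ∂θ, ∀ h, equivariantMap S φ (S.act h x) = shift h (equivariantMap S φ x) := by
  have hmul : ∀ᵐ x ∂θ, ∀ h g, S.act (g⁻¹ * h) x = S.act g⁻¹ (S.act h x) :=
    ae_all_iff.2 fun h => ae_all_iff.2 fun g => S.act_mul g⁻¹ h
  filter_upwards [hmul] with x hx h
  funext g
  simp [equivariantMap, shift, ← hx]

variable [MeasurableSpace A]

theorem isShiftInvariant_map_equivariantMap [Countable Γ] (hφ : Measurable φ) :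
    IsShiftInvariant (θ.map (equivariantMap S φ)) := by
  intro g
  have hm := measurable_equivariantMap S hφ
  have hcomm : shift g ∘ equivariantMap S φ =ᵐ[θ] equivariantMap S φ ∘ S.act g := by
    filter_upwards [ae_equivariantMap_act S φ] with x hx using (hx g).symm
  rw [Measure.map_map (measurable_shift g) hm, Measure.map_congr hcomm,
    ← Measure.map_map hm (S.measurePreserving g).measurable, (S.measurePreserving g).map_eq]

theorem isFactorMap_equivariantMap [Countable Γ] (hφ : Measurable φ) {ν : Measure (Γ → A)}
    (hν : IsShiftInvariant ν) (h : θ.map (equivariantMap S φ) = ν) :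
    IsFactorMap S (shiftSystem hν) (equivariantMap S φ) where
  aemeasurable := (measurable_equivariantMap S hφ).aemeasurable
  map_eq := h
  equivariant g := by filter_upwards [ae_equivariantMap_act S φ] with x hx using hx g

theorem IsFactorMap.exists_equivariantMap [Countable Γ] {ν : Measure (Γ → A)}
    {hν : IsShiftInvariant ν} {Φ : X → Γ → A} (hΦ : IsFactorMap S (shiftSystem hν) Φ) :
    ∃ φ : X → A, Measurable φ ∧ Φ =ᵐ[θ] equivariantMap S φ := by
  have hΦ₁ : AEMeasurable (fun x => Φ x 1) θ :=
    (measurable_pi_apply (1 : Γ)).comp_aemeasurable hΦ.aemeasurable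
  have hΦeq : Φ =ᵐ[θ] equivariantMap S fun x => Φ x 1 := by
    filter_upwards [ae_all_iff.2 hΦ.equivariant] with x hx
    funext g
    simp [equivariantMap, hx, shiftSystem, shift]
  exact ⟨hΦ₁.mk, hΦ₁.measurable_mk, hΦeq.trans (equivariantMap_ae_congr S hΦ₁.ae_eq_mk)⟩

theorem equivariantMap_shiftSystem_eval_one {ν : Measure (Γ → A)} (hν : IsShiftInvariant ν) :
    equivariantMap (shiftSystem hν) (fun b : Γ → A => b 1) = id := by
  funext b g
  simp [equivariantMap, shiftSystem, shift]

end EquivariantMap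

section IsModel

variable {Γ V X A B : Type*} [Group Γ] [Fintype V] [MeasurableSpace X] {θ : Measure X}
  {S : PMPAction Γ θ} {W : Finset Γ} {η η' : ℝ} {φ φ' : X → A} {x : V → A}

theorem IsModel.mono {σ : Γ → Equiv.Perm V} {W' : Finset Γ} (hx : IsModel σ S φ W η x)
    (hW : W' ⊆ W) (hη : η ≤ η') : IsModel σ S φ W' η' x :=
  fun E hE => (hx E (hE.mono hW)).trans_le hη

theorem IsModel.comp {σ : Γ → Equiv.Perm V} (hx : IsModel σ S φ W η x) (f : A → B) :
    IsModel σ S (f ∘ φ) W η (f ∘ x) := fun E hE =>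
  hx {a | f ∘ a ∈ E} fun _ _ hab => propext <| hE.mem_iff fun g hg => congrArg f (hab g hg)

theorem IsModel.of_measureReal_ne_le [IsFiniteMeasure θ] {σ : Γ → Equiv.Perm V}
    (hx : IsModel σ S φ' W η x) (hφ : NullMeasurableSet {y | φ y ≠ φ' y} θ)
    (hη : η + W.card * θ.real {y | φ y ≠ φ' y} ≤ η') : IsModel σ S φ W η' x := by
  intro E hE
  have h₁ := abs_measureReal_equivariantMap_sub_le S hφ hE
  rw [abs_sub_comm] at h₁
  linarith [hx E hE, abs_sub_le (freq {v | pullbackName σ x v ∈ E})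
    (θ.real {y | equivariantMap S φ' y ∈ E}) (θ.real {y | equivariantMap S φ y ∈ E})]

theorem IsModel.blockCode [Countable Γ] [DecidableEq Γ] {σ : Γ →* Equiv.Perm V} {W₀ : Finset Γ}
    (hx : IsModel σ S φ (Finset.image₂ (· * ·) W W₀) η x) {f : (Γ → A) → B}
    (hf : DependsOn f (W₀ : Set Γ)) :
    IsModel σ S (f ∘ equivariantMap S φ) W η (f ∘ pullbackName σ x) := by
  intro E hE
  have hloc : IsLocal (Finset.image₂ (· * ·) W W₀)
      {a : Γ → A | (fun h => f (shift h⁻¹ a)) ∈ E} := by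
    refine fun a b hab => propext <| hE.mem_iff fun h hh => hf fun g hg => ?_
    change a (h⁻¹⁻¹ * g) = b (h⁻¹⁻¹ * g)
    exact (inv_inv h).symm ▸ hab (h * g) (Finset.mem_image₂_of_mem hh hg)
  have hname : ∀ v, pullbackName σ (f ∘ pullbackName σ x) v =
      fun h => f (shift h⁻¹ (pullbackName σ x v)) := by
    intro v
    funext h
    refine congrArg f (funext fun g => ?_)
    simp [shift, pullbackName]
  have hlaw : {y | equivariantMap S (f ∘ equivariantMap S φ) y ∈ E} =ᵐ[θ]
      {y | (fun h => f (shift h⁻¹ (equivariantMap S φ y))) ∈ E} := by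
    refine eventuallyEq_set.2 ?_
    filter_upwards [ae_equivariantMap_act S φ] with y hy
    simp only [← hy]
    rfl
  rw [measureReal_congr hlaw]
  simpa only [hname, Set.mem_ofPred_eq] using hx _ hloc

theorem isModel_iff_forall_abs_sub_lt [Nonempty V] {σ : Γ → Equiv.Perm V} [Finite A]
    [MeasurableSpace A] [MeasurableSingletonClass A] {ν : ProbabilityMeasure (Γ → A)}
    (hν : θ.map (equivariantMap S φ) = ν) (hφ : Measurable φ) :
    IsModel σ S φ W η x ↔ ∀ E, IsLocal W E →
      |(empiricalMeasure σ x : Measure (Γ → A)).real E - (ν : Measure (Γ → A)).real E| < η := by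
  refine forall₂_congr fun E hE => ?_
  rw [empiricalMeasure_real _ _ hE.measurableSet, ← hν,
    map_measureReal_apply (measurable_equivariantMap S hφ) hE.measurableSet]
  rfl

end IsModel

section HasModels

variable {Γ X A B : Type*} [Group Γ] {V : ℕ → Type*} [∀ n, Fintype (V n)] [MeasurableSpace X]
  {θ : Measure X} {S : PMPAction Γ θ} {φ φ' : X → A}

theorem HasModels.comp {σ : ∀ n, Γ → Equiv.Perm (V n)} (h : HasModels σ S φ) (f : A → B) :
    HasModels σ S (f ∘ φ) := fun W η hη => by
  filter_upwards [h W η hη] with n ⟨x, hx⟩ using ⟨f ∘ x, hx.comp f⟩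

theorem HasModels.blockCode [Countable Γ] {σ : ∀ n, Γ →* Equiv.Perm (V n)}
    (h : HasModels (fun n => σ n) S φ) {W₀ : Finset Γ} {f : (Γ → A) → B}
    (hf : DependsOn f (W₀ : Set Γ)) : HasModels (fun n => σ n) S (f ∘ equivariantMap S φ) := by
  classical
  intro W η hη
  filter_upwards [h (Finset.image₂ (· * ·) W W₀) η hη] with n ⟨x, hx⟩ using ⟨_, hx.blockCode hf⟩

theorem HasModels.of_approx [IsFiniteMeasure θ] {σ : ∀ n, Γ → Equiv.Perm (V n)}
    (h : ∀ η : ℝ, 0 < η → ∃ φ' : X → A, HasModels σ S φ' ∧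
      NullMeasurableSet {y | φ y ≠ φ' y} θ ∧ θ.real {y | φ y ≠ φ' y} ≤ η) :
    HasModels σ S φ := by
  intro W η hη
  obtain ⟨φ', hφ', hnull, hdist⟩ := h (η / 2 / (W.card + 1)) (by positivity)
  filter_upwards [hφ' W (η / 2) (half_pos hη)] with n ⟨x, hx⟩
  refine ⟨x, hx.of_measureReal_ne_le hnull ?_⟩
  calc η / 2 + W.card * θ.real {y | φ y ≠ φ' y}
      ≤ η / 2 + (W.card + 1) * (η / 2 / (W.card + 1)) := by gcongr; linarith
    _ = η := by field_simp; ring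

theorem HasModels.congr_ae [IsFiniteMeasure θ] {σ : ∀ n, Γ → Equiv.Perm (V n)}
    (h : HasModels σ S φ') (hφ : φ =ᵐ[θ] φ') : HasModels σ S φ :=
  have hnull : θ {y | φ y ≠ φ' y} = 0 := ae_iff.1 hφ
  .of_approx fun η hη => ⟨φ', h, .of_null hnull, by simpa [measureReal_def, hnull] using hη.le⟩

theorem AllModels.hasModels {σ : ∀ n, Γ → Equiv.Perm (V n)} (h : AllModels σ S) [Finite A]
    [MeasurableSpace A] [MeasurableSingletonClass A] (hφ : Measurable φ) : HasModels σ S φ := by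
  obtain ⟨m, ⟨e⟩⟩ := Finite.exists_equiv_fin A
  have := (h m (e ∘ φ) ((measurable_of_finite e).comp hφ)).comp e.symm
  rwa [← Function.comp_assoc, e.symm_comp_self, Function.id_comp] at this

end HasModels

section Microstates

variable {Γ X A : Type*} [Group Γ] [Countable Γ] {V : ℕ → Type*} [∀ n, Fintype (V n)]
  [∀ n, Nonempty (V n)] {σ : ∀ n, Γ → Equiv.Perm (V n)} [MeasurableSpace X] {θ : Measure X}
  {S : PMPAction Γ θ} [Finite A] [TopologicalSpace A] [DiscreteTopology A] [MeasurableSpace A]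
  [BorelSpace A] {ν : ProbabilityMeasure (Γ → A)} {φ : X → A}

theorem hasMicrostates_iff_hasModels (hν : θ.map (equivariantMap S φ) = ν) (hφ : Measurable φ) :
    HasMicrostates σ ν ↔ HasModels σ S φ := by
  constructor
  · intro h W η hη
    filter_upwards [h _ (eventually_nhds_forall_isLocal ν W hη)] with n ⟨x, hx⟩
    exact ⟨x, (isModel_iff_forall_abs_sub_lt hν hφ).2 hx⟩
  · intro h O hO
    obtain ⟨W, η, hη, hWη⟩ := exists_local_nhds hO
    filter_upwards [h W η hη] with n ⟨x, hx⟩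
    exact ⟨x, hWη _ ((isModel_iff_forall_abs_sub_lt hν hφ).1 hx)⟩

theorem systemHasMicrostates_iff_allModels [IsProbabilityMeasure θ] :
    SystemHasMicrostates σ S ↔ AllModels σ S := by
  constructor
  · intro h m φ hφ
    let : TopologicalSpace (Fin m) := ⊥
    have : DiscreteTopology (Fin m) := ⟨rfl⟩
    have : BorelSpace (Fin m) := ⟨borel_eq_top_of_discrete.symm⟩
    have hinv := isShiftInvariant_map_equivariantMap (S := S) hφ
    exact (hasMicrostates_iff_hasModels rfl hφ).1 (h (Fin m) (equivariantLaw S hφ) hinv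
      (equivariantMap S φ) (isFactorMap_equivariantMap hφ hinv rfl))
  · intro h B _ _ _ _ _ ν hν Φ hΦ
    obtain ⟨φ, hφ, hΦφ⟩ := hΦ.exists_equivariantMap
    exact (hasMicrostates_iff_hasModels (Measure.map_congr hΦφ ▸ hΦ.map_eq) hφ).2 (h.hasModels hφ)

end Microstates

/-! ### Approximation of finite-valued maps -/

section Approximation

variable {X A : Type*} [Finite A] [MeasurableSpace A]

theorem exists_finset_forall_mem_iff_of_mem_generateSetAlgebra {G : Set (Set X)} {D : Set X}
    (hD : D ∈ generateSetAlgebra G) :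
    ∃ t : Finset (Set X), ↑t ⊆ G ∧ ∀ x y, (∀ C ∈ t, (x ∈ C ↔ y ∈ C)) → (x ∈ D ↔ y ∈ D) := by
  classical
  induction hD with
  | base s hs => exact ⟨{s}, by simpa using hs, fun x y h => h s (by simp)⟩
  | empty => exact ⟨∅, by simp, fun x y _ => by simp⟩
  | compl s _ ih =>
    obtain ⟨t, ht, h⟩ := ih
    exact ⟨t, ht, fun x y hxy => not_congr (h x y hxy)⟩
  | union s u _ _ ihs ihu =>
    obtain ⟨t, ht, h⟩ := ihs
    obtain ⟨t', ht', h'⟩ := ihu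
    exact ⟨t ∪ t', by simp [ht, ht'], fun x y hxy => or_congr
      (h x y fun C hC => hxy C (Finset.mem_union_left _ hC))
      (h' x y fun C hC => hxy C (Finset.mem_union_right _ hC))⟩

theorem measurable_epsilon_mem [Nonempty A] [MeasurableSpace X] {D : A → Set X}
    (hD : ∀ a, MeasurableSet (D a)) : Measurable fun x => Classical.epsilon fun a => x ∈ D a :=
  (measurable_of_finite (Classical.epsilon : (A → Prop) → A)).comp
    (measurable_pi_lambda _ fun a => measurableSet_setOfPred.1 (hD a))

variable [MeasurableSingletonClass A]

open scoped symmDiff in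
theorem exists_approx_of_generateFrom [mX : MeasurableSpace X] {μ : Measure X}
    [IsProbabilityMeasure μ] {G : Set (Set X)} (hG : mX = MeasurableSpace.generateFrom G)
    {φ : X → A} (hφ : Measurable φ) {η : ℝ} (hη : 0 < η) :
    ∃ (t : Finset (Set X)) (φ' : X → A), ↑t ⊆ G ∧ Measurable φ' ∧
      (∀ x y, (∀ C ∈ t, (x ∈ C ↔ y ∈ C)) → φ' x = φ' y) ∧ μ.real {x | φ x ≠ φ' x} ≤ η := by
  classical
  cases nonempty_fintype A
  have : Nonempty A := (nonempty_of_isProbabilityMeasure μ).map φ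
  have halg := isSetAlgebra_generateSetAlgebra (𝒜 := G)
  have hgen : mX = MeasurableSpace.generateFrom (generateSetAlgebra G) := by
    rw [generateFrom_generateSetAlgebra_eq, hG]
  have hη' : 0 < η / Fintype.card A := by positivity
  choose D hD hDμ using fun a => exists_measure_symmDiff_lt_of_generateFrom_isSetRing (μ := μ)
    halg.isSetRing ⟨{Set.univ}, by simp, by simpa using halg.univ_mem, by simp⟩ hgen
    (hφ (measurableSet_singleton a)) (ENNReal.ofReal_pos.2 hη')
  choose t ht htD using fun a => exists_finset_forall_mem_iff_of_mem_generateSetAlgebra (hD a)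
  have hDm (a : A) : MeasurableSet (D a) := hgen ▸ .basic _ (hD a)
  refine ⟨Finset.univ.biUnion t, fun x => Classical.epsilon fun a => x ∈ D a, by simpa using ht,
    measurable_epsilon_mem hDm, fun x y hxy => ?_, ?_⟩
  · refine congrArg Classical.epsilon (funext fun a => propext (htD a x y fun C hC => ?_))
    exact hxy C (Finset.mem_biUnion.2 ⟨a, Finset.mem_univ a, hC⟩)
  have hsub : {x | φ x ≠ Classical.epsilon fun a => x ∈ D a} ⊆
      ⋃ a ∈ Finset.univ, D a ∆ (φ ⁻¹' {a}) := by
    intro x hx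
    by_contra hcon
    have hmem (a : A) : x ∈ D a ↔ φ x = a := by
      simp only [Set.mem_iUnion, Finset.mem_univ, exists_true_left, not_exists] at hcon
      simpa [Set.mem_symmDiff, iff_iff_implies_and_implies, imp_iff_not_or, or_comm] using hcon a
    exact hx ((hmem _).1 (Classical.epsilon_spec (p := (x ∈ D ·)) ⟨φ x, (hmem _).2 rfl⟩))
  calc μ.real {x | φ x ≠ Classical.epsilon fun a => x ∈ D a}
      ≤ μ.real (⋃ a ∈ Finset.univ, D a ∆ (φ ⁻¹' {a})) := measureReal_mono hsub (measure_ne_top _ _)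
    _ ≤ ∑ a, μ.real (D a ∆ (φ ⁻¹' {a})) := measureReal_biUnion_finset_le _ _
    _ ≤ ∑ _a : A, η / Fintype.card A := Finset.sum_le_sum fun a _ =>
        ENNReal.toReal_le_of_le_ofReal hη'.le (hDμ a).le
    _ = η := by simp [mul_div_cancel₀]

theorem exists_dependsOn_measureReal_ne_le {ι : Type*} {α : ι → Type*} [∀ i, MeasurableSpace (α i)]
    {μ : Measure (∀ i, α i)} [IsProbabilityMeasure μ] {φ : (∀ i, α i) → A} (hφ : Measurable φ)
    {η : ℝ} (hη : 0 < η) :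
    ∃ (W : Finset ι) (φ' : (∀ i, α i) → A), DependsOn φ' (W : Set ι) ∧ Measurable φ' ∧
      μ.real {x | φ x ≠ φ' x} ≤ η := by
  classical
  obtain ⟨t, φ', ht, hφ', hdet, hdist⟩ := exists_approx_of_generateFrom (μ := μ)
    generateFrom_measurableCylinders.symm hφ hη
  choose! W P _ hWP using fun C hC => (mem_measurableCylinders C).1 (ht hC)
  refine ⟨t.biUnion W, φ', fun x y hxy => hdet x y fun C hC => ?_, hφ', hdist⟩
  rw [hWP C hC, mem_cylinder, mem_cylinder]
  suffices (W C).restrict x = (W C).restrict y by rw [this]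
  exact funext fun g => hxy g (Finset.mem_biUnion.2 ⟨C, hC, g.2⟩)

theorem exists_measurable_fin_forall_mem_iff [MeasurableSpace X] {ι : Type*} [Finite ι]
    {C : ι → Set X} (hC : ∀ i, MeasurableSet (C i)) :
    ∃ (m : ℕ) (β : X → Fin m), Measurable β ∧
      ∀ x y, β x = β y → ∀ i, (x ∈ C i ↔ y ∈ C i) := by
  obtain ⟨m, ⟨e⟩⟩ := Finite.exists_equiv_fin (ι → Prop)
  refine ⟨m, fun x => e fun i => x ∈ C i, (measurable_of_finite e).comp
    (measurable_pi_lambda _ fun i => measurableSet_setOfPred.1 (hC i)), fun x y hxy i => ?_⟩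
  exact iff_of_eq (congrFun (e.injective hxy) i)

theorem prod_pi_eq_generateFrom {Γ Y K : Type*} [Nonempty Γ] [MeasurableSpace Y]
    [MeasurableSpace K] :
    (Prod.instMeasurableSpace : MeasurableSpace (Y × (Γ → K))) =
      MeasurableSpace.generateFrom {E | ∃ (C : Set Y) (g : Γ) (D : Set K), MeasurableSet C ∧
        MeasurableSet D ∧ E = {p | p.1 ∈ C ∧ p.2 g ∈ D}} := by
  refine le_antisymm (sup_le ?_ ?_) (MeasurableSpace.generateFrom_le ?_)
  · rintro _ ⟨C, hC, rfl⟩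
    exact .basic _ ⟨C, Classical.arbitrary Γ, Set.univ, hC, .univ, by ext; simp⟩
  · rw [MeasurableSpace.pi, MeasurableSpace.comap_iSup]
    refine iSup_le fun g => ?_
    rintro _ ⟨_, ⟨D, hD, rfl⟩, rfl⟩
    exact .basic _ ⟨Set.univ, g, D, .univ, hD, by ext; simp⟩
  · rintro _ ⟨C, g, D, hC, hD, rfl⟩
    exact (measurable_fst hC).inter (((measurable_pi_apply g).comp measurable_snd) hD)

theorem exists_approx_prod_pi {Γ Y K : Type*} [Nonempty Γ] [MeasurableSpace Y]
    [MeasurableSpace K] {μ : Measure (Y × (Γ → K))} [IsProbabilityMeasure μ]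
    {φ : Y × (Γ → K) → A} (hφ : Measurable φ) {η : ℝ} (hη : 0 < η) :
    ∃ (k l : ℕ) (β : Y → Fin k) (γ : K → Fin l) (W : Finset Γ) (f : Fin k × (W → Fin l) → A),
      Measurable β ∧ Measurable γ ∧
        μ.real {p | φ p ≠ f (β p.1, fun g => γ (p.2 g))} ≤ η := by
  classical
  have : Nonempty A := (nonempty_of_isProbabilityMeasure μ).map φ
  obtain ⟨u, φ', hu, -, hdet, hdist⟩ := exists_approx_of_generateFrom (μ := μ)
    prod_pi_eq_generateFrom hφ hη
  choose C g D hC hD hE using fun E : u => hu E.2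
  obtain ⟨k, β, hβ, hβC⟩ := exists_measurable_fin_forall_mem_iff hC
  obtain ⟨l, γ, hγ, hγD⟩ := exists_measurable_fin_forall_mem_iff hD
  let W := Finset.univ.image g
  let code (p : Y × (Γ → K)) : Fin k × (W → Fin l) := (β p.1, fun g => γ (p.2 g))
  have hfactor : φ'.FactorsThrough code := by
    intro p q hpq
    refine hdet p q fun E hEu => ?_
    have hγ_eq : γ (p.2 (g ⟨E, hEu⟩)) = γ (q.2 (g ⟨E, hEu⟩)) :=
      congrFun (congrArg Prod.snd hpq) ⟨_, Finset.mem_image_of_mem g (Finset.mem_univ ⟨E, hEu⟩)⟩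
    rw [show E = _ from hE ⟨E, hEu⟩]
    exact and_congr (hβC _ _ (congrArg Prod.fst hpq) _) (hγD _ _ hγ_eq _)
  obtain ⟨f, hf⟩ := (Function.factorsThrough_iff φ').1 hfactor
  exact ⟨k, l, β, γ, W, f, hβ, hγ, by rwa [hf] at hdist⟩

end Approximation

theorem HasMicrostates.allModels {Γ : Type*} [Group Γ] [Countable Γ] {V : ℕ → Type*}
    [∀ n, Fintype (V n)] [∀ n, Nonempty (V n)] {σ : ∀ n, Γ →* Equiv.Perm (V n)}
    {B : Type*} [Finite B] [TopologicalSpace B] [DiscreteTopology B]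
    [MeasurableSpace B] [BorelSpace B] {ν : ProbabilityMeasure (Γ → B)}
    (h : HasMicrostates (fun n => ⇑(σ n)) ν) (hν : IsShiftInvariant (ν : Measure (Γ → B))) :
    AllModels (fun n => ⇑(σ n)) (shiftSystem hν) := by
  intro m φ hφ
  have hid := equivariantMap_shiftSystem_eval_one hν
  have hbase : HasModels (fun n => ⇑(σ n)) (shiftSystem hν) (fun b : Γ → B => b 1) :=
    (hasMicrostates_iff_hasModels (by rw [hid, Measure.map_id]) (measurable_pi_apply 1)).1 h
  refine .of_approx fun η hη => ?_
  obtain ⟨W, φ', hdep, hφ', hdist⟩ :=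
    exists_dependsOn_measureReal_ne_le (μ := (ν : Measure (Γ → B))) hφ hη
  refine ⟨φ', ?_, (measurableSet_eq_fun hφ hφ').compl.nullMeasurableSet, hdist⟩
  simpa only [hid, Function.comp_id] using hbase.blockCode hdep

/-! ### Random labellings -/

open ProbabilityTheory

section SecondMoment

variable {Ω : Type*} [MeasurableSpace Ω] {P : Measure Ω} [IsProbabilityMeasure P]

theorem memLp_two_indicator_one {C : Set Ω} (hC : MeasurableSet C) :
    MemLp (C.indicator (1 : Ω → ℝ)) 2 P :=
  (memLp_const 1).indicator hC

theorem covariance_indicator_one {C D : Set Ω} (hC : MeasurableSet C) (hD : MeasurableSet D) :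
    cov[C.indicator 1, D.indicator 1; P] = P.real (C ∩ D) - P.real C * P.real D := by
  rw [covariance_eq_sub (memLp_two_indicator_one hC) (memLp_two_indicator_one hD),
    ← Set.inter_indicator_one, integral_indicator_one (hC.inter hD), integral_indicator_one hC,
    integral_indicator_one hD]

theorem variance_sum_indicator_one_le {V : Type*} {C : V → Set Ω} (hC : ∀ v, MeasurableSet (C v))
    (G : Finset V) {N : ℕ} (nbr : V → Finset V) (hnbr : ∀ v, (nbr v).card ≤ N)
    (hindep : ∀ v ∈ G, ∀ w ∈ G, w ∉ nbr v → IndepSet (C v) (C w) P) :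
    Var[∑ v ∈ G, (C v).indicator (1 : Ω → ℝ); P] ≤ G.card * N := by
  classical
  have hcov : ∀ v ∈ G, ∀ w ∈ G, cov[(C v).indicator 1, (C w).indicator 1; P] ≤
      if w ∈ nbr v then 1 else 0 := by
    intro v hv w hw
    rw [covariance_indicator_one (hC v) (hC w)]
    split_ifs with h
    · have hprod : 0 ≤ P.real (C v) * P.real (C w) := by positivity
      linarith [measureReal_le_one (μ := P) (s := C v ∩ C w)]
    · rw [measureReal_def, (hindep v hv w hw h).measure_inter_eq_mul, ENNReal.toReal_mul]
      exact (sub_self _).le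
  rw [variance_sum' fun v _ => memLp_two_indicator_one (hC v)]
  calc _ ≤ ∑ v ∈ G, ∑ w ∈ G, if w ∈ nbr v then (1 : ℝ) else 0 :=
        Finset.sum_le_sum fun v hv => Finset.sum_le_sum fun w hw => hcov v hv w hw
    _ ≤ ∑ _v ∈ G, (N : ℝ) := Finset.sum_le_sum fun v _ => by
        rw [Finset.sum_boole]
        exact_mod_cast (Finset.card_le_card fun w hw => (Finset.mem_filter.1 hw).2).trans (hnbr v)
    _ = G.card * N := by simp

theorem exists_forall_sq_sub_integral_le {I : Type*} [Fintype I] {X : I → Ω → ℝ}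
    (hX : ∀ i, MemLp (X i) 2 P) : ∃ ω, ∀ i, (X i ω - P[X i]) ^ 2 ≤ ∑ j, Var[X j; P] := by
  have hint (i : I) : Integrable (fun ω => (X i ω - P[X i]) ^ 2) P :=
    ((hX i).sub (memLp_const _)).integrable_sq
  obtain ⟨ω, hω⟩ := exists_le_integral (integrable_finsetSum Finset.univ fun i _ => hint i)
  refine ⟨ω, fun i => ?_⟩
  calc (X i ω - P[X i]) ^ 2 ≤ ∑ j, (X j ω - P[X j]) ^ 2 :=
        Finset.single_le_sum (f := fun j => (X j ω - P[X j]) ^ 2) (fun _ _ => sq_nonneg _)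
          (Finset.mem_univ i)
    _ ≤ ∑ j, Var[X j; P] := by
        simpa only [integral_finsetSum Finset.univ fun i _ => hint i,
          ← variance_eq_integral (hX _).aemeasurable] using hω

theorem exists_forall_sq_ncard_sub_le {V I : Type*} [Finite V] [Fintype I] {C : I → V → Set Ω}
    (hC : ∀ i v, MeasurableSet (C i v)) (G : I → Finset V) :
    ∃ ω, ∀ i, (({v | v ∈ G i ∧ ω ∈ C i v}.ncard : ℝ) - ∑ v ∈ G i, P.real (C i v)) ^ 2 ≤
      ∑ j, Var[∑ v ∈ G j, (C j v).indicator (1 : Ω → ℝ); P] := by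
  classical
  cases nonempty_fintype V
  obtain ⟨ω, hω⟩ := exists_forall_sq_sub_integral_le (P := P)
    (X := fun i => ∑ v ∈ G i, (C i v).indicator (1 : Ω → ℝ))
    fun i => memLp_finsetSum' _ fun v _ => memLp_two_indicator_one (hC i v)
  refine ⟨ω, fun i => ?_⟩
  have hmean : P[∑ v ∈ G i, (C i v).indicator (1 : Ω → ℝ)] = ∑ v ∈ G i, P.real (C i v) := by
    simp only [Finset.sum_apply]
    rw [integral_finsetSum _ fun v _ => (integrable_const 1).indicator (hC i v)]
    exact Finset.sum_congr rfl fun v _ => integral_indicator_one (hC i v)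
  have hcount : (∑ v ∈ G i, (C i v).indicator (1 : Ω → ℝ)) ω = {v | v ∈ G i ∧ ω ∈ C i v}.ncard := by
    simp only [Finset.sum_apply, Set.indicator_apply, Pi.one_apply, Finset.sum_boole,
      Set.ncard_eq_toFinset_card']
    congr 2
    ext v
    simp
  exact hmean ▸ hcount ▸ hω i

end SecondMoment

/-- The labellings of `V` that show at `v` the pattern `R`, when the window `ι` is placed at `v` by
the maps `s g`. -/
def patternAt {V ι K : Type*} (s : ι → V → V) (R : ι → Set K) (v : V) : Set (V → K) :=
  {k | ∀ g, k (s g v) ∈ R g}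

section PatternAt

variable {V ι K : Type*} [MeasurableSpace K] {κ : Measure K}
  {s : ι → V → V} {R : ι → Set K} {v w : V}

theorem measurableSet_patternAt [Finite ι] (s : ι → V → V) (hR : ∀ g, MeasurableSet (R g)) (v : V) :
    MeasurableSet (patternAt s R v) := by
  simp only [patternAt, Set.ofPred_forall]
  exact .iInter fun g => measurable_pi_apply (s g v) (hR g)

variable [Fintype V] [IsProbabilityMeasure κ]

theorem iIndepFun_eval_pi (V : Type*) [Fintype V] (κ : Measure K) [IsProbabilityMeasure κ] :
    iIndepFun (fun (v : V) (k : V → K) => k v) (Measure.pi fun _ => κ) :=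
  iIndepFun_pi (X := fun _ => id) fun _ => aemeasurable_id

theorem pi_real_patternAt [Fintype ι] (hR : ∀ g, MeasurableSet (R g))
    (hv : Function.Injective fun g => s g v) :
    (Measure.pi fun _ : V => κ).real (patternAt s R v) = ∏ g, κ.real (R g) := by
  have h := ((iIndepFun_eval_pi V κ).precomp hv).measure_inter_preimage_eq_mul Finset.univ
    (sets := R) fun g _ => hR g
  have hset : patternAt s R v = ⋂ g ∈ Finset.univ, (fun k : V → K => k (s g v)) ⁻¹' R g := by
    ext; simp [patternAt]
  rw [hset, measureReal_def, h, ENNReal.toReal_prod]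
  refine Finset.prod_congr rfl fun g _ => ?_
  exact (measurePreserving_eval (fun _ : V => κ) (s g v)).measureReal_preimage
    (hR g).nullMeasurableSet

theorem indepSet_patternAt [Finite ι] (hR : ∀ g, MeasurableSet (R g))
    (h : ∀ g g', s g v ≠ s g' w) :
    IndepSet (patternAt s R v) (patternAt s R w) (Measure.pi fun _ : V => κ) := by
  classical
  cases nonempty_fintype ι
  let orbit (u : V) : Finset V := Finset.univ.image fun g => s g u
  have hmem (u : V) (g : ι) : s g u ∈ orbit u := Finset.mem_image_of_mem _ (Finset.mem_univ g)
  let Q (u : V) : Set (orbit u → K) := {k | ∀ g, k ⟨s g u, hmem u g⟩ ∈ R g}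
  have hQ (u : V) : MeasurableSet (Q u) := by
    simp only [Q, Set.ofPred_forall]
    exact .iInter fun g => measurable_pi_apply _ (hR g)
  have hdisj : Disjoint (orbit v) (orbit w) := by
    simp only [orbit, Finset.disjoint_left, Finset.mem_image, Finset.mem_univ, true_and]
    rintro _ ⟨g, rfl⟩ ⟨g', hg'⟩
    exact h g g' hg'.symm
  have hind := (iIndepFun_eval_pi V κ).indepFun_finset (orbit v) (orbit w) hdisj
    measurable_pi_apply
  exact (indepSet_iff_measure_inter_eq_mul (measurableSet_patternAt s hR v)
    (measurableSet_patternAt s hR w) _).2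
    (hind.measure_inter_preimage_eq_mul (Q v) (Q w) (hQ v) (hQ w))

theorem variance_sum_indicator_patternAt_le [Fintype ι] {s : ι → Equiv.Perm V}
    (hR : ∀ g, MeasurableSet (R g)) (G : Finset V) :
    Var[∑ v ∈ G, (patternAt (fun g => s g) R v).indicator (1 : (V → K) → ℝ);
      Measure.pi fun _ : V => κ] ≤ Fintype.card V * Fintype.card ι ^ 2 := by
  classical
  let nbr (v : V) : Finset V := Finset.univ.image fun p : ι × ι => (s p.2).symm (s p.1 v)
  have hnbr (v : V) : (nbr v).card ≤ Fintype.card ι ^ 2 :=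
    Finset.card_image_le.trans_eq (by simp [sq])
  refine (variance_sum_indicator_one_le (fun v => measurableSet_patternAt _ hR v) G nbr hnbr
    fun v _ w _ hw => indepSet_patternAt hR fun g g' hgg' => hw ?_).trans ?_
  · exact Finset.mem_image.2 ⟨(g, g'), Finset.mem_univ _, by simp [hgg']⟩
  · push_cast
    gcongr
    exact Finset.card_le_univ G

theorem abs_sum_pi_real_patternAt_sub_le [Fintype ι] (hR : ∀ g, MeasurableSet (R g))
    (G : Finset V) :
    |∑ v ∈ G, (Measure.pi fun _ : V => κ).real (patternAt s R v) - G.card * ∏ g, κ.real (R g)| ≤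
      {v | ¬ Function.Injective fun g => s g v}.ncard := by
  classical
  have hprod : ∏ g, κ.real (R g) ∈ Set.Icc (0 : ℝ) 1 :=
    ⟨Finset.prod_nonneg fun _ _ => measureReal_nonneg,
      Finset.prod_le_one (fun _ _ => measureReal_nonneg) fun _ _ => measureReal_le_one⟩
  have hterm (v : V) : |(Measure.pi fun _ : V => κ).real (patternAt s R v) - ∏ g, κ.real (R g)| ≤
      if Function.Injective fun g => s g v then 0 else 1 := by
    split_ifs with hv
    · simp [pi_real_patternAt hR hv]
    · exact abs_sub_le_of_nonneg_of_le measureReal_nonneg measureReal_le_one hprod.1 hprod.2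
  rw [← nsmul_eq_mul, ← Finset.sum_const, ← Finset.sum_sub_distrib]
  calc _ ≤ ∑ v ∈ G, |(Measure.pi fun _ : V => κ).real (patternAt s R v) - ∏ g, κ.real (R g)| :=
        Finset.abs_sum_le_sum_abs _ _
    _ ≤ ∑ v, if Function.Injective fun g => s g v then (0 : ℝ) else 1 :=
        (Finset.sum_le_sum fun v _ => hterm v).trans <| Finset.sum_le_univ_sum_of_nonneg fun v => by
          split_ifs <;> norm_num
    _ = _ := by simp [Finset.sum_ite, Set.ncard_eq_toFinset_card']

end PatternAt

theorem exists_forall_abs_freq_patternAt_sub_le {V ι K I : Type*} [Fintype V] [Nonempty V]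
    [Fintype ι] [Fintype I] [MeasurableSpace K] (κ : Measure K) [IsProbabilityMeasure κ]
    (s : ι → Equiv.Perm V) {R : I → ι → Set K} (hR : ∀ i g, MeasurableSet (R i g))
    (G : I → Set V) {η : ℝ} (hη : 0 ≤ η)
    (hcard : Fintype.card I * (Fintype.card ι : ℝ) ^ 2 ≤ η ^ 2 * Fintype.card V) :
    ∃ k : V → K, ∀ i,
      |freq {v | v ∈ G i ∧ k ∈ patternAt (fun g => s g) (R i) v} -
          freq (G i) * ∏ g, κ.real (R i g)| ≤
        η + freq {v | ¬ Function.Injective fun g => s g v} := by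
  classical
  let C (i : I) (v : V) : Set (V → K) := patternAt (fun g => s g) (R i) v
  obtain ⟨k, hk⟩ := exists_forall_sq_ncard_sub_le (P := Measure.pi fun _ : V => κ)
    (C := C) (fun i v => measurableSet_patternAt _ (hR i) v) fun i => (G i).toFinset
  simp only [Set.mem_toFinset] at hk
  refine ⟨k, fun i => ?_⟩
  have hdev : |({v | v ∈ G i ∧ k ∈ C i v}.ncard : ℝ) -
      ∑ v ∈ (G i).toFinset, (Measure.pi fun _ : V => κ).real (C i v)| ≤ η * Fintype.card V := by
    refine abs_le_of_sq_le_sq ?_ (by positivity)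
    calc _ ≤ ∑ j, Var[∑ v ∈ (G j).toFinset, (C j v).indicator 1; Measure.pi fun _ : V => κ] :=
          hk i
      _ ≤ ∑ _j : I, (Fintype.card V * Fintype.card ι ^ 2 : ℝ) :=
          Finset.sum_le_sum fun j _ => variance_sum_indicator_patternAt_le (hR j) _
      _ = Fintype.card I * Fintype.card ι ^ 2 * Fintype.card V := by simp; ring
      _ ≤ η ^ 2 * Fintype.card V * Fintype.card V := by gcongr
      _ = (η * Fintype.card V) ^ 2 := by ring
  have hexp := abs_sum_pi_real_patternAt_sub_le (κ := κ) (s := fun g => s g) (hR i) (G i).toFinset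
  have hVpos : (0 : ℝ) < Fintype.card V := by exact_mod_cast Fintype.card_pos
  rw [← Set.ncard_eq_toFinset_card'] at hexp
  unfold freq
  rw [div_mul_eq_mul_div, ← sub_div, abs_div, abs_of_pos hVpos, div_le_iff₀ hVpos, add_mul,
    div_mul_cancel₀ _ hVpos.ne']
  exact (abs_sub_le _ _ _).trans (add_le_add hdev hexp)

section Sofic

variable {Γ : Type*} [Group Γ] {V : ℕ → Type*} [∀ n, Fintype (V n)]
  {σ : ∀ n, Γ →* Equiv.Perm (V n)}

theorem tendsto_freq_not_injective (hσ : IsSoficApproximation fun n => σ n) (W : Finset Γ) :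
    Tendsto (fun n => freq {v | ¬ Function.Injective fun g : W => σ n (g : Γ)⁻¹ v}) atTop
      (𝓝 0) := by
  classical
  have hlim : Tendsto (fun n => ∑ p ∈ W.offDiag, freq {v | σ n (p.2 * p.1⁻¹) v = v}) atTop
      (𝓝 0) := by
    rw [← Finset.sum_const_zero (s := W.offDiag)]
    refine tendsto_finsetSum _ fun p hp => hσ.2 _ fun h => ?_
    exact (Finset.mem_offDiag.1 hp).2.2 (mul_inv_eq_one.1 h).symm
  refine squeeze_zero (fun _ => freq_nonneg _) (fun n => ?_) hlim
  refine (freq_mono ?_).trans (freq_biUnion_le _ _)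
  intro v hv
  simp only [Set.mem_ofPred_eq, Function.Injective, not_forall] at hv
  obtain ⟨g, h, hgh, hne⟩ := hv
  refine Set.mem_biUnion (x := ((g : Γ), (h : Γ)))
    (Finset.mem_coe.2 (Finset.mem_offDiag.2 ⟨g.2, h.2, fun hgh => hne (Subtype.ext hgh)⟩)) ?_
  rw [Set.mem_ofPred_eq, map_mul, Equiv.Perm.mul_apply, hgh, ← Equiv.Perm.mul_apply, ← map_mul,
    mul_inv_cancel, map_one, Equiv.Perm.one_apply]

variable [∀ n, Nonempty (V n)]

theorem tendsto_card_atTop (hσ : IsSoficApproximation fun n => σ n)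
    (hV : Finite Γ → Tendsto (fun n => Fintype.card (V n)) atTop atTop) :
    Tendsto (fun n => Fintype.card (V n)) atTop atTop := by
  rcases finite_or_infinite Γ with hΓ | hΓ
  · exact hV hΓ
  refine tendsto_atTop.2 fun M => ?_
  obtain ⟨W, rfl⟩ := Infinite.exists_subset_card_eq Γ M
  filter_upwards [(tendsto_freq_not_injective hσ W).eventually_lt_const one_pos] with n hn
  obtain ⟨v, hv⟩ : ∃ v, Function.Injective fun g : W => σ n (g : Γ)⁻¹ v := by
    by_contra! hcon
    exact hn.ne (Set.eq_univ_of_forall hcon ▸ freq_univ)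
  simpa using Fintype.card_le_of_injective _ hv

theorem eventually_exists_labelling (hσ : IsSoficApproximation fun n => σ n)
    (hcard : Tendsto (fun n => Fintype.card (V n)) atTop atTop) {K I : Type*} [MeasurableSpace K]
    [Finite I] (κ : Measure K) [IsProbabilityMeasure κ] {W : Finset Γ} {R : I → W → Set K}
    (hR : ∀ i g, MeasurableSet (R i g)) {η : ℝ} (hη : 0 < η) :
    ∀ᶠ n in atTop, ∀ G : I → Set (V n), ∃ k : V n → K, ∀ i,
      |freq {v | v ∈ G i ∧ k ∈ patternAt (fun g : W => σ n (g : Γ)⁻¹) (R i) v} -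
        freq (G i) * ∏ g, κ.real (R i g)| < η := by
  cases nonempty_fintype I
  have hlarge : ∀ᶠ n in atTop,
      Fintype.card I * (Fintype.card W : ℝ) ^ 2 ≤ (η / 2) ^ 2 * Fintype.card (V n) :=
    (Tendsto.const_mul_atTop (by positivity)
      (tendsto_natCast_atTop_atTop.comp hcard)).eventually_ge_atTop _
  filter_upwards [hlarge, (tendsto_freq_not_injective hσ W).eventually_lt_const (half_pos hη)]
    with n hn hbad G
  obtain ⟨k, hk⟩ := exists_forall_abs_freq_patternAt_sub_le κ (fun g : W => σ n (g : Γ)⁻¹) hR G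
    (half_pos hη).le hn
  exact ⟨k, fun i => (hk i).trans_lt (by linarith)⟩

end Sofic

/-! ### Products with Bernoulli shifts -/

theorem freq_preimage_eq_sum {V P : Type*} [Fintype V] (u : V → P) (E : Finset P) :
    freq {v | u v ∈ E} = ∑ p ∈ E, freq {v | u v = p} := by
  classical
  have hfiber := Finset.card_eq_sum_card_fiberwise (f := u) (s := {v | u v ∈ E}) (t := E)
    fun v hv => by simpa using hv
  simp only [freq, Set.ncard_eq_toFinset_card', Set.toFinset_ofPred, ← Finset.sum_div, hfiber]
  push_cast
  congr 1
  refine Finset.sum_congr rfl fun p hp => ?_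
  rw [Finset.filter_filter]
  congr 2
  ext v
  simp only [Finset.mem_filter, Finset.mem_univ, true_and, and_iff_right_iff_imp]
  rintro rfl
  exact hp

theorem abs_freq_preimage_sub_le {V X P : Type*} [Fintype V] [MeasurableSpace X] [Finite P]
    {θ : Measure X} [IsFiniteMeasure θ] {u : V → P} {w : X → P}
    (hw : ∀ p, MeasurableSet (w ⁻¹' {p})) {η : ℝ}
    (h : ∀ p, |freq {v | u v = p} - θ.real (w ⁻¹' {p})| ≤ η) (E : Set P) :
    |freq {v | u v ∈ E} - θ.real (w ⁻¹' E)| ≤ Nat.card P * η := by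
  cases nonempty_fintype P
  lift E to Finset P using E.toFinite
  simp only [Finset.mem_coe]
  rw [freq_preimage_eq_sum, ← sum_measureReal_preimage_singleton _ fun p _ => hw p,
    ← Finset.sum_sub_distrib]
  calc _ ≤ ∑ p ∈ E, |freq {v | u v = p} - θ.real (w ⁻¹' {p})| :=
        Finset.abs_sum_le_sum_abs _ _
    _ ≤ ∑ p, |freq {v | u v = p} - θ.real (w ⁻¹' {p})| :=
        Finset.sum_le_univ_sum_of_nonneg fun _ => abs_nonneg _
    _ ≤ ∑ _p : P, η := Finset.sum_le_sum fun p _ => h p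
    _ = Nat.card P * η := by simp

theorem isModel_of_forall_pattern {Γ V X A : Type*} [Group Γ] [Fintype V] [MeasurableSpace X]
    {θ : Measure X} [IsFiniteMeasure θ] [Finite A] [MeasurableSpace A]
    [MeasurableSingletonClass A] {σ : Γ → Equiv.Perm V} {S : PMPAction Γ θ} {φ : X → A}
    (hφ : Measurable φ) {W : Finset Γ} {η η' : ℝ} {x : V → A}
    (h : ∀ p : W → A, |freq {v | ∀ g : W, pullbackName σ x v g = p g} -
      θ.real {y | ∀ g : W, equivariantMap S φ y g = p g}| ≤ η')
    (hη : Nat.card (W → A) * η' < η) : IsModel σ S φ W η x := by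
  intro E hE
  let u (v : V) : W → A := W.restrict (pullbackName σ x v)
  let w (y : X) : W → A := W.restrict (equivariantMap S φ y)
  have hw : Measurable w := W.measurable_restrict.comp (measurable_equivariantMap S hφ)
  have hpat (p : W → A) : |freq {v | u v = p} - θ.real (w ⁻¹' {p})| ≤ η' := by
    simpa only [u, w, Set.preimage, Set.mem_singleton_iff, funext_iff, Finset.restrict] using h p
  rw [hE.eq_cylinder]
  exact (abs_freq_preimage_sub_le (fun p => hw (measurableSet_singleton p)) hpat _).trans_lt hη

theorem bernoulliMeasure_real_setOf_forall_mem {Γ K : Type*} [MeasurableSpace K] (κ : Measure K)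
    [IsProbabilityMeasure κ] {W : Finset Γ} {R : W → Set K} (hR : ∀ g, MeasurableSet (R g)) :
    (bernoulliMeasure Γ κ).real {z | ∀ g : W, z g ∈ R g} = ∏ g, κ.real (R g) := by
  have hcyl : {z : Γ → K | ∀ g : W, z g ∈ R g} = cylinder W (Set.univ.pi R) := by
    ext z
    simp [Finset.restrict]
  rw [hcyl, bernoulliMeasure, measureReal_def,
    Measure.infinitePi_cylinder _ (.univ_pi hR), Measure.pi_pi, ENNReal.toReal_prod]
  rfl

section Product

variable {Γ Y K : Type*} [Group Γ] [MeasurableSpace Y] {θ : Measure Y} [IsProbabilityMeasure θ]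
  {S : PMPAction Γ θ} [MeasurableSpace K] {κ : Measure K} [IsProbabilityMeasure κ]

theorem equivariantMap_prod_bernoulliShift {B L : Type*} (β : Y → B) (γ : K → L)
    (p : Y × (Γ → K)) (g : Γ) :
    equivariantMap (S.prod (bernoulliShift Γ κ)) (fun p => (β p.1, γ (p.2 1))) p g =
      (equivariantMap S β p.1 g, γ (p.2 g)) := by
  simp [equivariantMap, PMPAction.prod, bernoulliShift, shiftSystem, shift]

theorem measureReal_prod_bernoulliMeasure_pattern {B L : Type*} [MeasurableSpace L]
    [MeasurableSingletonClass L] (β : Y → B) {γ : K → L} (hγ : Measurable γ) {W : Finset Γ}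
    (p : W → B × L) :
    (θ.prod (bernoulliMeasure Γ κ)).real {y | ∀ g : W,
        equivariantMap (S.prod (bernoulliShift Γ κ)) (fun p => (β p.1, γ (p.2 1))) y g = p g} =
      θ.real {y | ∀ g : W, equivariantMap S β y g = (p g).1} * ∏ g, κ.real (γ ⁻¹' {(p g).2}) := by
  rw [← bernoulliMeasure_real_setOf_forall_mem (Γ := Γ) κ fun g => hγ (measurableSet_singleton _),
    ← measureReal_prod_prod]
  congr 1
  ext y
  simp [equivariantMap_prod_bernoulliShift, Prod.ext_iff, forall_and]

theorem IsModel.prod_bernoulliShift {V : Type*} [Fintype V] {σ : Γ → Equiv.Perm V}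
    {B L : Type*} [Finite B] [Finite L] [MeasurableSpace B] [MeasurableSpace L]
    [MeasurableSingletonClass B] [MeasurableSingletonClass L] {β : Y → B} (hβ : Measurable β)
    {γ : K → L} (hγ : Measurable γ) {W : Finset Γ} {η η' : ℝ} {b : V → B}
    (hb : IsModel σ S β W η' b) {k : V → K}
    (hk : ∀ p : W → B × L,
      |freq {v | (∀ g : W, pullbackName σ b v g = (p g).1) ∧
          k ∈ patternAt (fun g : W => σ (g : Γ)⁻¹) (fun g => γ ⁻¹' {(p g).2}) v} -
        freq {v | ∀ g : W, pullbackName σ b v g = (p g).1} *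
          ∏ g, κ.real (γ ⁻¹' {(p g).2})| < η')
    (hη : Nat.card (W → B × L) * (2 * η') < η) :
    IsModel σ (S.prod (bernoulliShift Γ κ)) (fun p => (β p.1, γ (p.2 1))) W η
      fun v => (b v, γ (k v)) := by
  have hmeas : Measurable fun p : Y × (Γ → K) => (β p.1, γ (p.2 1)) := by fun_prop
  refine isModel_of_forall_pattern hmeas (fun p => ?_) hη
  rw [measureReal_prod_bernoulliMeasure_pattern β hγ p]
  set c := ∏ g, κ.real (γ ⁻¹' {(p g).2})
  have hc : c ∈ Set.Icc (0 : ℝ) 1 := ⟨Finset.prod_nonneg fun _ _ => measureReal_nonneg,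
    Finset.prod_le_one (fun _ _ => measureReal_nonneg) fun _ _ => measureReal_le_one⟩
  have hbp := hb _ (isLocal_setOf_forall_eq W fun g => (p g).1)
  have hname : {v | ∀ g : W, pullbackName σ (fun v => (b v, γ (k v))) v g = p g} =
      {v | (∀ g : W, pullbackName σ b v g = (p g).1) ∧
        k ∈ patternAt (fun g : W => σ (g : Γ)⁻¹) (fun g => γ ⁻¹' {(p g).2}) v} := by
    ext v
    simp [pullbackName, patternAt, Prod.ext_iff, forall_and]
  rw [hname, two_mul]
  refine (abs_sub_le _ _ _).trans (add_le_add (hk p).le ?_)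
  rw [← sub_mul, abs_mul, abs_of_nonneg hc.1]
  exact (mul_le_of_le_one_right (abs_nonneg _) hc.2).trans hbp.le

variable {V : ℕ → Type*} [∀ n, Fintype (V n)] [∀ n, Nonempty (V n)]
  {σ : ∀ n, Γ →* Equiv.Perm (V n)}

theorem HasModels.prod_bernoulliShift (hσ : IsSoficApproximation fun n => σ n)
    (hcard : Tendsto (fun n => Fintype.card (V n)) atTop atTop) {B L : Type*} [Finite B]
    [Finite L] [MeasurableSpace B] [MeasurableSpace L] [MeasurableSingletonClass B]
    [MeasurableSingletonClass L] {β : Y → B} (hβ : Measurable β)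
    (h : HasModels (fun n => σ n) S β) {γ : K → L} (hγ : Measurable γ) :
    HasModels (fun n => σ n) (S.prod (bernoulliShift Γ κ)) fun p => (β p.1, γ (p.2 1)) := by
  intro W η hη
  let N : ℝ := Nat.card (W → B × L)
  have hη' : 0 < η / (2 * N + 1) := by positivity
  filter_upwards [h W _ hη', eventually_exists_labelling hσ hcard κ
    (fun (p : W → B × L) g => hγ (measurableSet_singleton (p g).2)) hη'] with n ⟨b, hb⟩ hk
  obtain ⟨k, hk⟩ := hk fun p => {v | ∀ g : W, pullbackName (σ n) b v g = (p g).1}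
  refine ⟨_, hb.prod_bernoulliShift hβ hγ hk ?_⟩
  change N * (2 * (η / (2 * N + 1))) < η
  rw [← mul_assoc, mul_div_assoc', div_lt_iff₀ (by positivity)]
  nlinarith

theorem AllModels.prod_bernoulliShift [Countable Γ] (hσ : IsSoficApproximation fun n => σ n)
    (hcard : Tendsto (fun n => Fintype.card (V n)) atTop atTop)
    (hS : AllModels (fun n => σ n) S) (κ : Measure K) [IsProbabilityMeasure κ] :
    AllModels (fun n => σ n) (S.prod (bernoulliShift Γ κ)) := by
  classical
  intro m φ hφ
  refine .of_approx fun η hη => ?_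
  obtain ⟨k, l, β, γ, W, f, hβ, hγ, hdist⟩ := exists_approx_prod_pi
    (μ := θ.prod (bernoulliMeasure Γ κ)) hφ hη
  let f' (c : Γ → Fin k × Fin l) : Fin m := f ((c 1).1, fun g : W => (c g).2)
  have hf' : DependsOn f' (insert 1 W : Finset Γ) := by
    intro c d hcd
    simp only [f']
    rw [hcd 1 (by simp)]
    congr 2
    funext g
    rw [hcd g (by simp)]
  have hmodels := ((hS.hasModels hβ).prod_bernoulliShift (κ := κ) hσ hcard hβ hγ).blockCode hf'
  refine ⟨fun p => f (β p.1, fun g => γ (p.2 g)), hmodels.congr_ae ?_, ?_, hdist⟩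
  · filter_upwards [Measure.quasiMeasurePreserving_fst.ae S.act_one] with p hp
    simp only [f', equivariantMap_prod_bernoulliShift, Function.comp]
    simp only [equivariantMap, inv_one, hp, id]
  · refine (measurableSet_eq_fun hφ ?_).compl.nullMeasurableSet
    fun_prop

end Product

/-! ### Resampling the Bernoulli coordinate step by step -/

theorem measurePreserving_piecewise_infinitePi {ι : Type*} {X : ι → Type*}
    [∀ i, MeasurableSpace (X i)] (μ : ∀ i, Measure (X i)) [∀ i, IsProbabilityMeasure (μ i)]
    (s : Set ι) [∀ i, Decidable (i ∈ s)] :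
    MeasurePreserving (fun p : (∀ i, X i) × (∀ i, X i) => s.piecewise p.1 p.2)
      ((Measure.infinitePi μ).prod (Measure.infinitePi μ)) (Measure.infinitePi μ) := by
  have hm : Measurable fun p : (∀ i, X i) × (∀ i, X i) => s.piecewise p.1 p.2 := by
    refine measurable_pi_lambda _ fun i => ?_
    by_cases hi : i ∈ s
    · simp only [Set.piecewise_eq_of_mem _ _ _ hi]
      fun_prop
    · simp only [Set.piecewise_eq_of_notMem _ _ _ hi]
      fun_prop
  refine ⟨hm, Measure.eq_infinitePi _ fun t R hR => ?_⟩
  have hpre : (fun p : (∀ i, X i) × (∀ i, X i) => s.piecewise p.1 p.2) ⁻¹' ((t : Set ι).pi R) =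
      ((t.filter (· ∈ s) : Finset ι) : Set ι).pi R ×ˢ
        ((t.filter (· ∉ s) : Finset ι) : Set ι).pi R := by
    ext p
    simp only [Set.mem_preimage, Set.mem_pi, Set.mem_prod, Finset.coe_filter, Set.mem_ofPred_eq,
      Finset.mem_coe, Set.piecewise, and_imp, ← forall_and]
    refine forall₂_congr fun i _ => ?_
    by_cases hi : i ∈ s <;> simp [hi]
  rw [Measure.map_apply hm (.pi t.countable_toSet fun i _ => hR i), hpre, Measure.prod_prod,
    Measure.infinitePi_pi _ fun i _ => hR i, Measure.infinitePi_pi _ fun i _ => hR i,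
    Finset.prod_filter_mul_prod_filter_not]

section Resample

variable {Γ Y K : Type*} {N : ℕ}

/-- The point `((y, z), z')` of `(Y × K^Γ) × K^Γ` together with a clock `u : Γ → Fin N` is sent to
the point of `Y × K^Γ` over `y` whose second coordinate is `z'` where the clock is less than `j`
and `z` elsewhere. As `j` grows from `0` to `N`, this replaces `z` by `z'` one clock value at a
time. -/
def resample (j : ℕ) (p : ((Y × (Γ → K)) × (Γ → K)) × (Γ → Fin N)) : Y × (Γ → K) :=
  (p.1.1.1, fun g => if (p.2 g : ℕ) < j then p.1.2 g else p.1.1.2 g)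

theorem resample_zero (p : ((Y × (Γ → K)) × (Γ → K)) × (Γ → Fin N)) : resample 0 p = p.1.1 := by
  simp [resample]

theorem resample_last (p : ((Y × (Γ → K)) × (Γ → K)) × (Γ → Fin N)) :
    resample N p = (p.1.1.1, p.1.2) := by
  simp [resample]

theorem resample_succ_snd_apply_of_ne {j : ℕ} {p : ((Y × (Γ → K)) × (Γ → K)) × (Γ → Fin N)} {g : Γ}
    (hg : (p.2 g : ℕ) ≠ j) : (resample (j + 1) p).2 g = (resample j p).2 g := by
  have : (p.2 g : ℕ) < j + 1 ↔ (p.2 g : ℕ) < j := by omega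
  simp only [resample, this]

variable [MeasurableSpace Y] [MeasurableSpace K]

/-- The space on which `resample` is defined carries the law of a point of the system, of an
independent second sample of its Bernoulli coordinate, and of an independent clock. -/
noncomputable abbrev resamplingMeasure (Γ : Type*) (θ : Measure Y) (κ : Measure K)
    [IsProbabilityMeasure κ] (τ : Measure (Fin N)) [IsProbabilityMeasure τ] :
    Measure (((Y × (Γ → K)) × (Γ → K)) × (Γ → Fin N)) :=
  ((θ.prod (bernoulliMeasure Γ κ)).prod (bernoulliMeasure Γ κ)).prod (bernoulliMeasure Γ τ)

theorem measurable_resample (j : ℕ) :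
    Measurable (resample j : ((Y × (Γ → K)) × (Γ → K)) × (Γ → Fin N) → Y × (Γ → K)) := by
  refine Measurable.prodMk (by fun_prop) (measurable_pi_lambda _ fun g => ?_)
  have hclock : Measurable fun p : ((Y × (Γ → K)) × (Γ → K)) × (Γ → Fin N) => p.2 g := by fun_prop
  exact .ite (hclock (Set.toFinite {i : Fin N | (i : ℕ) < j}).measurableSet) (by fun_prop)
    (by fun_prop)

variable {θ : Measure Y} [IsProbabilityMeasure θ] {κ : Measure K} [IsProbabilityMeasure κ]
  {τ : Measure (Fin N)} [IsProbabilityMeasure τ]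

theorem measurePreserving_resample (j : ℕ) :
    MeasurePreserving (resample j) (resamplingMeasure Γ θ κ τ) (θ.prod (bernoulliMeasure Γ κ)) := by
  let fiber (u : Γ → Fin N) (q : (Y × (Γ → K)) × (Γ → K)) : Y × (Γ → K) := resample j (q, u)
  have hfiber (u : Γ → Fin N) : MeasurePreserving (fiber u)
      ((θ.prod (bernoulliMeasure Γ κ)).prod (bernoulliMeasure Γ κ))
      (θ.prod (bernoulliMeasure Γ κ)) :=
    ((MeasurePreserving.id θ).prod ((measurePreserving_piecewise_infinitePi (fun _ => κ)
      {g | (u g : ℕ) < j}).comp Measure.measurePreserving_swap)).comp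
      (measurePreserving_prodAssoc θ (bernoulliMeasure Γ κ) (bernoulliMeasure Γ κ))
  have hskew := (MeasurePreserving.id (bernoulliMeasure Γ τ)).skew_product (g := fiber)
    ((measurable_resample j).comp measurable_swap) (ae_of_all _ fun u => (hfiber u).map_eq)
  exact (measurePreserving_snd.comp hskew).comp Measure.measurePreserving_swap

theorem isFactorMap_resample [Group Γ] (S : PMPAction Γ θ) (j : ℕ) :
    IsFactorMap (((S.prod (bernoulliShift Γ κ)).prod (bernoulliShift Γ κ)).prod
      (bernoulliShift Γ τ)) (S.prod (bernoulliShift Γ κ)) (resample j) where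
  aemeasurable := (measurable_resample j).aemeasurable
  map_eq := (measurePreserving_resample j).map_eq
  equivariant _ := ae_of_all _ fun _ => rfl

theorem measureReal_clock_eq (g : Γ) (i : Fin N) :
    (resamplingMeasure Γ θ κ τ).real {p | p.2 g = i} = τ.real {i} :=
  ((measurePreserving_eval_infinitePi (fun _ : Γ => τ) g).comp
    (measurePreserving_snd (μ := (θ.prod (bernoulliMeasure Γ κ)).prod
      (bernoulliMeasure Γ κ)))).measureReal_preimage (measurableSet_singleton i).nullMeasurableSet

theorem measureReal_resample_succ_ne_le {A : Type*} {φ φ' : Y × (Γ → K) → A}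
    (hφ : NullMeasurableSet {p | φ p ≠ φ' p} (θ.prod (bernoulliMeasure Γ κ))) {W : Finset Γ}
    (hφ' : ∀ y, DependsOn (fun z => φ' (y, z)) (W : Set Γ)) (j : Fin N) :
    (resamplingMeasure Γ θ κ τ).real {p | φ (resample j p) ≠ φ (resample (j + 1) p)} ≤
      2 * (θ.prod (bernoulliMeasure Γ κ)).real {p | φ p ≠ φ' p} + W.card * τ.real {j} := by
  have hsub : {p | φ (resample j p) ≠ φ (resample (j + 1) p)} ⊆
      (resample j ⁻¹' {p | φ p ≠ φ' p} ∪ resample (j + 1) ⁻¹' {p | φ p ≠ φ' p}) ∪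
        ⋃ g ∈ W, {p | p.2 g = j} := by
    intro p hp
    by_contra hgood
    simp only [Set.mem_union, Set.mem_preimage, Set.mem_ofPred_eq, Set.mem_iUnion, not_or,
      not_not, not_exists] at hgood
    obtain ⟨⟨hj, hsucc⟩, hclock⟩ := hgood
    have hφ'_eq : φ' (resample j p) = φ' (resample (j + 1) p) := hφ' _ fun g hg =>
      (resample_succ_snd_apply_of_ne fun h => hclock g hg (Fin.ext h)).symm
    exact hp (hj.trans (hφ'_eq.trans hsucc.symm))
  have hclose (i : ℕ) : (resamplingMeasure Γ θ κ τ).real (resample i ⁻¹' {p | φ p ≠ φ' p}) =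
      (θ.prod (bernoulliMeasure Γ κ)).real {p | φ p ≠ φ' p} :=
    (measurePreserving_resample i).measureReal_preimage hφ
  calc _ ≤ _ := measureReal_mono hsub
    _ ≤ _ := (measureReal_union_le _ _).trans
      (add_le_add (measureReal_union_le _ _) (measureReal_biUnion_finset_le _ _))
    _ = _ := by simp only [hclose, measureReal_clock_eq, two_mul, Finset.sum_const, nsmul_eq_mul]

theorem exists_forall_measureReal_resample_succ_ne_lt [Nonempty Γ] {A : Type*} [Finite A]
    [MeasurableSpace A] [MeasurableSingletonClass A] {φ : Y × (Γ → K) → A} (hφ : Measurable φ)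
    {η : ℝ} (hη : 0 < η) :
    ∃ (N : ℕ) (τ : Measure (Fin N)) (_ : IsProbabilityMeasure τ), ∀ j : Fin N,
      (resamplingMeasure Γ θ κ τ).real {p | φ (resample j p) ≠ φ (resample (j + 1) p)} < η := by
  obtain ⟨k, l, β, γ, W, f, hβ, hγ, hdist⟩ := exists_approx_prod_pi
    (μ := θ.prod (bernoulliMeasure Γ κ)) hφ (show 0 < η / 4 by positivity)
  obtain ⟨N, hN⟩ := exists_nat_gt (W.card / (η / 2))
  refine ⟨N + 1, ProbabilityTheory.uniformOn Set.univ, inferInstance, fun j => ?_⟩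
  have hj : (ProbabilityTheory.uniformOn (Set.univ : Set (Fin (N + 1)))).real {j} =
      1 / (N + 1) := by
    simp [measureReal_def, ProbabilityTheory.uniformOn_univ, ENNReal.toReal_add]
  have hφ' : Measurable fun p : Y × (Γ → K) => f (β p.1, fun g => γ (p.2 g)) := by fun_prop
  refine (measureReal_resample_succ_ne_le (measurableSet_eq_fun hφ hφ').compl.nullMeasurableSet
    (W := W) (fun y z z' hz => ?_) j).trans_lt ?_
  · simp only [fun g : W => hz g g.2]
  · have hW : (W.card : ℝ) * (1 / (N + 1)) < η / 2 := by
      rw [div_lt_iff₀ (by positivity)] at hN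
      rw [mul_one_div, div_lt_iff₀ (by positivity)]
      linarith
    rw [hj]
    linarith

end Resample

/-! ### Totally shattered microstate spaces -/

section FactorMap

variable {Γ X Y A : Type*} [Group Γ] [MeasurableSpace X] {θ : Measure X} [MeasurableSpace Y]
  {ν : Measure Y} {T : PMPAction Γ θ} {S : PMPAction Γ ν} {π : X → Y}

theorem IsFactorMap.measureReal_preimage (hπ : IsFactorMap T S π) {s : Set Y}
    (hs : MeasurableSet s) : θ.real (π ⁻¹' s) = ν.real s := by
  simp only [measureReal_def, ← hπ.map_eq, Measure.map_apply_of_aemeasurable hπ.aemeasurable hs]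

theorem IsFactorMap.equivariantMap_comp_ae_eq [Countable Γ] (hπ : IsFactorMap T S π) (φ : Y → A) :
    equivariantMap T (φ ∘ π) =ᵐ[θ] equivariantMap S φ ∘ π := by
  filter_upwards [ae_all_iff.2 hπ.equivariant] with x hx
  exact funext fun g => congrArg φ (hx g⁻¹)

end FactorMap

section ModelStatistics

variable {Γ V X Y A : Type*} [Group Γ] [Fintype V] [MeasurableSpace X] {θ : Measure X}
  [MeasurableSpace Y] {ν : Measure Y} {T : PMPAction Γ θ} {S : PMPAction Γ ν} {W : Finset Γ}
  {η : ℝ}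

theorem isModel_comp_iff_of_isFactorMap [Countable Γ] [Finite A] [MeasurableSpace A]
    [MeasurableSingletonClass A] {σ : Γ → Equiv.Perm V} {π : X → Y} (hπ : IsFactorMap T S π)
    {φ : Y → A} (hφ : Measurable φ) {x : V → A} :
    IsModel σ T (φ ∘ π) W η x ↔ IsModel σ S φ W η x := by
  refine forall₂_congr fun E hE => ?_
  have hlaw : {p | equivariantMap T (φ ∘ π) p ∈ E} =ᵐ[θ] π ⁻¹' {y | equivariantMap S φ y ∈ E} :=
    (hπ.equivariantMap_comp_ae_eq φ).fun_comp (· ∈ E)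
  have hE' : MeasurableSet {y | equivariantMap S φ y ∈ E} :=
    measurable_equivariantMap S hφ hE.measurableSet
  rw [measureReal_congr hlaw, hπ.measureReal_preimage hE']

theorem IsModel.abs_freq_sub_lt {σ : Γ →* Equiv.Perm V} {φ : X → A} {x : V → A}
    (hx : IsModel σ T φ W η x) (hW : 1 ∈ W) (P : Set A) :
    |freq {v | x v ∈ P} - θ.real {p | φ p ∈ P}| < η := by
  have hloc : IsLocal W {a : Γ → A | a 1 ∈ P} := fun a b hab => congrArg (· ∈ P) (hab 1 hW)
  have hlaw : {p | equivariantMap T φ p 1 ∈ P} =ᵐ[θ] {p | φ p ∈ P} := by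
    refine eventuallyEq_set.2 ?_
    filter_upwards [T.act_one] with p hp
    simp [equivariantMap, hp]
  have h := hx _ hloc
  simp only [Set.mem_ofPred_eq] at h
  rw [measureReal_congr hlaw] at h
  simpa [pullbackName] using h

theorem IsModel.abs_normHamming_sub_lt {ι : Type*} {σ : Γ →* Equiv.Perm V} {φ : X → ι → A}
    {x : V → ι → A} (hx : IsModel σ T φ W η x) (hW : 1 ∈ W) (i j : ι) :
    |normHamming (x · i) (x · j) - θ.real {p | φ p i ≠ φ p j}| < η :=
  hx.abs_freq_sub_lt hW {a | a i ≠ a j}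

end ModelStatistics

theorem normHamming_lt_of_forall_step_lt {V A : Type*} [Fintype V] {N : ℕ}
    {x : Fin (N + 1) → V → A} {δ ε : ℝ} (hδ : 0 < δ)
    (hdich : ∀ j, δ ≤ normHamming (x 0) (x j) ∨ normHamming (x 0) (x j) < ε)
    (hstep : ∀ j : Fin N, normHamming (x j.castSucc) (x j.succ) ≤ δ - ε) (j : Fin (N + 1)) :
    normHamming (x 0) (x j) < ε := by
  have hzero : normHamming (x 0) (x 0) = 0 := by simp [normHamming]
  induction j using Fin.induction with
  | zero => exact (hdich 0).resolve_left (by linarith)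
  | succ j ih =>
    have := normHamming_triangle (x 0) (x j.castSucc) (x j.succ)
    exact (hdich j.succ).resolve_left (by linarith [hstep j])

theorem measureReal_resample_zero_ne_resample_last {Γ Y K A : Type*} {N : ℕ} [MeasurableSpace Y]
    [MeasurableSpace K] {θ : Measure Y} {κ : Measure K} [IsProbabilityMeasure κ]
    {τ : Measure (Fin N)} [IsProbabilityMeasure τ] [Countable A] [MeasurableSpace A]
    [MeasurableSingletonClass A] {φ : Y × (Γ → K) → A} (hφ : Measurable φ) :
    (resamplingMeasure Γ θ κ τ).real {p | φ (resample 0 p) ≠ φ (resample N p)} =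
      (θ.prod ((bernoulliMeasure Γ κ).prod (bernoulliMeasure Γ κ))).real
        {p | φ (p.1, p.2.1) ≠ φ (p.1, p.2.2)} := by
  have hmeas : MeasurableSet {p : Y × (Γ → K) × (Γ → K) | φ (p.1, p.2.1) ≠ φ (p.1, p.2.2)} :=
    (measurableSet_eq_fun (hφ.comp (by fun_prop)) (hφ.comp (by fun_prop))).compl
  have hproj := (measurePreserving_prodAssoc θ (bernoulliMeasure Γ κ)
    (bernoulliMeasure Γ κ)).comp (measurePreserving_fst (ν := bernoulliMeasure Γ τ))
  rw [← hproj.measureReal_preimage hmeas.nullMeasurableSet]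
  simp only [resample_zero, resample_last]
  rfl

theorem HasTotallyShatteredMicrostates.exists_nhds_forall_measureReal_ne_lt.{u, v} {Γ A : Type*}
    [Group Γ] [Countable Γ] {V : ℕ → Type*} [∀ n, Fintype (V n)] [∀ n, Nonempty (V n)]
    {σ : ∀ n, Γ →* Equiv.Perm (V n)} [Finite A] [TopologicalSpace A] [DiscreteTopology A]
    [MeasurableSpace A] [BorelSpace A] {μ : ProbabilityMeasure (Γ → A)}
    (hμ : HasTotallyShatteredMicrostates (fun n => σ n) μ)
    (hσ : IsSoficApproximation fun n => σ n)
    (hcard : Tendsto (fun n => Fintype.card (V n)) atTop atTop) {ε : ℝ} (hε : 0 < ε) :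
    ∃ O ∈ 𝓝 μ, ∀ (Y : Type u) [MeasurableSpace Y] (θ : Measure Y) [IsProbabilityMeasure θ]
      (S : PMPAction Γ θ), AllModels (fun n => σ n) S →
      ∀ (K : Type v) [MeasurableSpace K] (κ : Measure K) [IsProbabilityMeasure κ]
        (φ : Y × (Γ → K) → A) (hφ : Measurable φ),
        equivariantLaw (S.prod (bernoulliShift Γ κ)) hφ ∈ O →
        (θ.prod ((bernoulliMeasure Γ κ).prod (bernoulliMeasure Γ κ))).real
          {p | φ (p.1, p.2.1) ≠ φ (p.1, p.2.2)} < ε := by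
  classical
  obtain ⟨-, δ, hδ, hdich⟩ := hμ
  obtain ⟨O, hO, n₀, hdich⟩ := hdich (min (ε / 2) (δ / 2)) (by positivity)
  refine ⟨interior O, interior_mem_nhds.2 hO, ?_⟩
  intro Y _ θ _ S hS K _ κ _ φ hφ hlaw
  obtain ⟨W, η, hη, hWη⟩ := exists_local_nhds (mem_interior_iff_mem_nhds.1 hlaw)
  obtain ⟨N, τ, _, hstep⟩ := exists_forall_measureReal_resample_succ_ne_lt (θ := θ) (κ := κ) hφ
    (show 0 < δ / 4 by positivity)
  have hmodels := ((hS.prod_bernoulliShift hσ hcard κ).prod_bernoulliShift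
    hσ hcard κ).prod_bernoulliShift hσ hcard τ
  let path (p : ((Y × (Γ → K)) × (Γ → K)) × (Γ → Fin N)) (j : Fin (N + 1)) : A := φ (resample j p)
  have hpath : Measurable path :=
    measurable_pi_lambda _ fun j => hφ.comp (measurable_resample j)
  obtain ⟨n, ⟨x, hx⟩, hn⟩ := ((hmodels.hasModels hpath (insert 1 W) (min η (min (δ / 4) (ε / 2)))
    (by positivity)).and (eventually_ge_atTop n₀)).exists
  have hmicro (j : Fin (N + 1)) : (x · j) ∈ microstates (σ n) O := by
    have hxj := (hx.mono (Finset.subset_insert 1 W) (min_le_left _ _)).comp fun a => a j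
    exact hWη _ ((isModel_iff_forall_abs_sub_lt rfl hφ).1
      ((isModel_comp_iff_of_isFactorMap (isFactorMap_resample S j) hφ).1 hxj))
  have hdist (i j : Fin (N + 1)) := (hx.mono subset_rfl (min_le_right _ _)).abs_normHamming_sub_lt
    (Finset.mem_insert_self 1 W) i j
  have hxstep (j : Fin N) :
      normHamming (x · j.castSucc) (x · j.succ) ≤ δ - min (ε / 2) (δ / 2) := by
    have hj := (lt_min_iff.1 (hdist j.castSucc j.succ)).1
    simp only [path, Fin.val_castSucc, Fin.val_succ] at hj
    linarith [(abs_lt.1 hj).2, hstep j, min_le_right (ε / 2) (δ / 2)]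
  have hend := normHamming_lt_of_forall_step_lt (x := fun j v => x v j) hδ
    (fun j => hdich n hn _ (hmicro 0) _ (hmicro j)) hxstep (Fin.last N)
  have htruth := (lt_min_iff.1 (hdist 0 (Fin.last N))).2
  rw [← measureReal_resample_zero_ne_resample_last (τ := τ) hφ]
  simp only [path, Fin.val_zero, Fin.val_last] at htruth
  linarith [(abs_lt.1 htruth).1, min_le_left (ε / 2) (δ / 2)]

/-! ### Factor maps from a product with a Bernoulli shift -/

section Factor

variable {Γ X Y Z A : Type*} [Group Γ] [MeasurableSpace X] {μ : Measure X}
  [IsProbabilityMeasure μ] {T : PMPAction Γ μ} [MeasurableSpace Y] {θ : Measure Y}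
  [IsProbabilityMeasure θ] {S : PMPAction Γ θ} [MeasurableSpace Z] {ζ : Measure Z}
  {R : PMPAction Γ ζ}

theorem IsFactorMap.allModels [Countable Γ] {V : ℕ → Type*} [∀ n, Fintype (V n)]
    {σ : ∀ n, Γ → Equiv.Perm (V n)} {ξ : X → Z} (hξ : IsFactorMap T R ξ)
    (h : AllModels σ T) : AllModels σ R := by
  intro m φ hφ W η hη
  have hmodels : HasModels σ T (φ ∘ ξ) :=
    (h m _ (hφ.comp hξ.aemeasurable.measurable_mk)).congr_ae
      (hξ.aemeasurable.ae_eq_mk.fun_comp φ)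
  filter_upwards [hmodels W η hη] with n ⟨x, hx⟩
  exact ⟨x, (isModel_comp_iff_of_isFactorMap hξ hφ).1 hx⟩

theorem IsFactorMap.comp_swap {Φ : X × Y → Z} (h : IsFactorMap (T.prod S) R Φ) :
    IsFactorMap (S.prod T) R (Φ ∘ Prod.swap) := by
  have hswap : MeasurePreserving Prod.swap (θ.prod μ) (μ.prod θ) := Measure.measurePreserving_swap
  refine ⟨h.aemeasurable.comp_quasiMeasurePreserving hswap.quasiMeasurePreserving, ?_, fun g =>
    hswap.quasiMeasurePreserving.ae (h.equivariant g)⟩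
  rw [← AEMeasurable.map_map_of_aemeasurable (by rw [hswap.map_eq]; exact h.aemeasurable)
    hswap.aemeasurable, hswap.map_eq, h.map_eq]

theorem isFactorMap_fst : IsFactorMap (T.prod S) T Prod.fst where
  aemeasurable := measurable_fst.aemeasurable
  map_eq := measurePreserving_fst.map_eq
  equivariant _ := ae_of_all _ fun _ => rfl

theorem isFactorMap_snd : IsFactorMap (T.prod S) S Prod.snd where
  aemeasurable := measurable_snd.aemeasurable
  map_eq := measurePreserving_snd.map_eq
  equivariant _ := ae_of_all _ fun _ => rfl

omit [IsProbabilityMeasure μ] in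
theorem IsFactorMap.map_equivariantMap_comp [Countable Γ] [MeasurableSpace A] {ξ : X → Z}
    (hξ : IsFactorMap T R ξ) {φ : Z → A} (hφ : Measurable φ) :
    μ.map (equivariantMap T (φ ∘ ξ)) = ζ.map (equivariantMap R φ) := by
  have hmap := AEMeasurable.map_map_of_aemeasurable
    (measurable_equivariantMap R hφ).aemeasurable hξ.aemeasurable
  rw [hξ.map_eq] at hmap
  rw [hmap, Measure.map_congr (hξ.equivariantMap_comp_ae_eq φ)]

end Factor

theorem exists_forall_ae_eq_of_ae_eq_resample {X Z A : Type*} [MeasurableSpace X] {μ : Measure X}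
    [SFinite μ] [MeasurableSpace Z] {ν : Measure Z} [SFinite ν] [NeZero ν] {φ : X × Z → A}
    (h : ∀ᵐ p ∂μ.prod (ν.prod ν), φ (p.1, p.2.1) = φ (p.1, p.2.2)) :
    ∃ z₀, ∀ᵐ p ∂μ.prod ν, φ p = φ (p.1, z₀) := by
  have h' : ∀ᵐ q ∂ν.prod (μ.prod ν), φ q.2 = φ (q.2.1, q.1) :=
    ((measurePreserving_prodAssoc μ ν ν).comp
      Measure.measurePreserving_swap).quasiMeasurePreserving.ae h
  exact (Measure.ae_ae_of_ae_prod h').exists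

theorem eq_dirac_of_ae_eq {X : Type*} [MeasurableSpace X] {μ : Measure X} [IsProbabilityMeasure μ]
    {x : X} (h : ∀ᵐ y ∂μ, y = x) : μ = Measure.dirac x := by
  calc μ = μ.map id := Measure.map_id.symm
    _ = μ.map fun _ => x := Measure.map_congr h
    _ = Measure.dirac x := by simp

theorem exists_eq_dirac_of_ae_bernoulliMeasure_eq {Γ K : Type*} [Nonempty Γ] [MeasurableSpace K]
    {κ : Measure K} [IsProbabilityMeasure κ] {z₀ : Γ → K}
    (h : ∀ᵐ z ∂bernoulliMeasure Γ κ, z = z₀) : ∃ k, κ = Measure.dirac k := by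
  obtain ⟨g⟩ := ‹Nonempty Γ›
  have heval : (bernoulliMeasure Γ κ).map (Function.eval g) = κ :=
    (measurePreserving_eval_infinitePi (fun _ : Γ => κ) g).map_eq
  refine ⟨z₀ g, ?_⟩
  rw [← heval, eq_dirac_of_ae_eq h, Measure.map_dirac' (measurable_pi_apply g)]

namespace HasTotallyShatteredMicrostates

variable {Γ A K : Type*} [Group Γ] [Countable Γ] {V : ℕ → Type*} [∀ n, Fintype (V n)]
  [∀ n, Nonempty (V n)] {σ : ∀ n, Γ →* Equiv.Perm (V n)} [Finite A] [TopologicalSpace A]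
  [DiscreteTopology A] [MeasurableSpace A] [BorelSpace A] {μ : ProbabilityMeasure (Γ → A)}
  {hμ : IsShiftInvariant (μ : Measure (Γ → A))} [MeasurableSpace K] {κ : Measure K}
  [IsProbabilityMeasure κ]

theorem ae_eq_resample {Y : Type*} [MeasurableSpace Y] {θ : Measure Y} [IsProbabilityMeasure θ]
    {S : PMPAction Γ θ} (h : HasTotallyShatteredMicrostates (fun n => σ n) μ)
    (hσ : IsSoficApproximation fun n => σ n)
    (hcard : Tendsto (fun n => Fintype.card (V n)) atTop atTop)
    (hS : AllModels (fun n => σ n) S) {φ : Y × (Γ → K) → A} (hφ : Measurable φ)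
    (hlaw : equivariantLaw (S.prod (bernoulliShift Γ κ)) hφ = μ) :
    ∀ᵐ p ∂θ.prod ((bernoulliMeasure Γ κ).prod (bernoulliMeasure Γ κ)),
      φ (p.1, p.2.1) = φ (p.1, p.2.2) := by
  refine (measureReal_eq_zero_iff (by finiteness)).1
    (le_antisymm (le_of_forall_pos_lt_add fun ε hε => ?_) measureReal_nonneg)
  obtain ⟨O, hO, hlt⟩ := h.exists_nhds_forall_measureReal_ne_lt hσ hcard hε
  rw [zero_add]
  exact hlt _ θ S hS _ κ φ hφ (hlaw ▸ mem_of_mem_nhds hO)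

theorem exists_factorization {Y : Type*} [MeasurableSpace Y] {θ : Measure Y}
    [IsProbabilityMeasure θ] {S : PMPAction Γ θ}
    (h : HasTotallyShatteredMicrostates (fun n => σ n) μ)
    (hσ : IsSoficApproximation fun n => σ n)
    (hcard : Tendsto (fun n => Fintype.card (V n)) atTop atTop)
    (hS : AllModels (fun n => σ n) S) {Φ : Y × (Γ → K) → Γ → A}
    (hΦ : IsFactorMap (S.prod (bernoulliShift Γ κ)) (shiftSystem hμ) Φ) :
    ∃ Ψ, IsFactorMap S (shiftSystem hμ) Ψ ∧
      ∀ᵐ p ∂θ.prod (bernoulliMeasure Γ κ), Φ p = Ψ p.1 := by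
  obtain ⟨φ, hφ, hΦφ⟩ := hΦ.exists_equivariantMap
  have hlaw : equivariantLaw (S.prod (bernoulliShift Γ κ)) hφ = μ :=
    Subtype.ext ((Measure.map_congr hΦφ).symm.trans hΦ.map_eq)
  obtain ⟨z₀, hz₀⟩ := exists_forall_ae_eq_of_ae_eq_resample (h.ae_eq_resample hσ hcard hS hφ hlaw)
  have hψ : Measurable fun y => φ (y, z₀) := hφ.comp (by fun_prop)
  have hΦψ : Φ =ᵐ[θ.prod (bernoulliMeasure Γ κ)]
      equivariantMap (S.prod (bernoulliShift Γ κ)) ((fun y => φ (y, z₀)) ∘ Prod.fst) :=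
    hΦφ.trans (equivariantMap_ae_congr _ hz₀)
  refine ⟨_, isFactorMap_equivariantMap hψ hμ ?_, hΦψ⟩
  exact (isFactorMap_fst.map_equivariantMap_comp hψ).symm.trans
    ((Measure.map_congr hΦψ).symm.trans hΦ.map_eq)

theorem exists_eq_dirac_of_isDirectFactor.{w}
    (h : HasTotallyShatteredMicrostates (fun n => σ n) μ)
    (hσ : IsSoficApproximation fun n => σ n)
    (hcard : Tendsto (fun n => Fintype.card (V n)) atTop atTop)
    (hdirect : IsDirectFactor.{w} (bernoulliShift Γ κ) (shiftSystem hμ)) :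
    ∃ k, κ = Measure.dirac k := by
  obtain ⟨Y, _, _, θ, _, S, π, ξ, -, hξ, -, Λ, hΛ, -, hright⟩ := hdirect
  obtain ⟨Ψ, -, hΛΨ⟩ :=
    h.exists_factorization hσ hcard (hξ.allModels (h.1.allModels hμ)) hΛ.comp_swap
  have hae : ∀ᵐ p ∂θ.prod (bernoulliMeasure Γ κ), p.2 = π (Ψ p.1) := by
    filter_upwards [hΛΨ, Measure.measurePreserving_swap.quasiMeasurePreserving.ae hright]
      with p h₁ h₂
    rw [← h₁]
    exact (congrArg Prod.fst h₂).symm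
  obtain ⟨y, hy⟩ := (Measure.ae_ae_of_ae_prod hae).exists
  exact exists_eq_dirac_of_ae_bernoulliMeasure_eq (z₀ := π (Ψ y)) hy

end HasTotallyShatteredMicrostates

/-! ### Weak containment -/

theorem shift_one {Γ A : Type*} [Group Γ] : (shift (1 : Γ) : (Γ → A) → Γ → A) = id := by
  funext x g
  simp [shift]

section PatternSets

variable {ι Y : Type*} [Fintype ι] [MeasurableSpace Y] {ν : Measure Y} {D : ι → Set Y} {ε : ℝ}

omit [Fintype ι] in
theorem sum_measureReal_le_measureReal_biUnion_add [IsFiniteMeasure ν]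
    (hD : ∀ i, MeasurableSet (D i)) (hinter : ∀ i j, i ≠ j → ν.real (D i ∩ D j) ≤ ε)
    (hε : 0 ≤ ε) (s : Finset ι) :
    ∑ i ∈ s, ν.real (D i) ≤ ν.real (⋃ i ∈ s, D i) + s.card ^ 2 * ε := by
  classical
  induction s using Finset.induction with
  | empty => simp
  | insert i s hi ih =>
    have hunion := measureReal_union_add_inter (μ := ν) (s := D i)
      (s.measurableSet_biUnion fun j _ => hD j) (measure_ne_top ν _) (measure_ne_top ν _)
    have hoverlap : ν.real (D i ∩ ⋃ j ∈ s, D j) ≤ s.card * ε := by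
      rw [Set.inter_iUnion₂]
      calc _ ≤ ∑ j ∈ s, ν.real (D i ∩ D j) := measureReal_biUnion_finset_le _ _
        _ ≤ ∑ _j ∈ s, ε := Finset.sum_le_sum fun j hj => hinter i j (by grind)
        _ = s.card * ε := by simp
    rw [Finset.sum_insert hi, Finset.set_biUnion_insert, Finset.card_insert_of_notMem hi]
    push_cast
    nlinarith [mul_nonneg s.card.cast_nonneg hε]

theorem sum_le_measureReal_biUnion_add [IsFiniteMeasure ν] (hD : ∀ i, MeasurableSet (D i))
    (hinter : ∀ i j, i ≠ j → ν.real (D i ∩ D j) ≤ ε) (hε : 0 ≤ ε) {a : ι → ℝ}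
    (ha : ∀ i, a i ≤ ν.real (D i) + ε) (s : Finset ι) :
    ∑ i ∈ s, a i ≤ ν.real (⋃ i ∈ s, D i) + (Fintype.card ι ^ 2 + Fintype.card ι) * ε := by
  have hcard : s.card ≤ Fintype.card ι := s.card_le_univ
  calc ∑ i ∈ s, a i ≤ ∑ i ∈ s, (ν.real (D i) + ε) := Finset.sum_le_sum fun i _ => ha i
    _ = ∑ i ∈ s, ν.real (D i) + s.card * ε := by simp [Finset.sum_add_distrib]
    _ ≤ ν.real (⋃ i ∈ s, D i) + s.card ^ 2 * ε + s.card * ε := by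
      gcongr
      exact sum_measureReal_le_measureReal_biUnion_add hD hinter hε s
    _ ≤ ν.real (⋃ i ∈ s, D i) + Fintype.card ι ^ 2 * ε + Fintype.card ι * ε := by gcongr
    _ = _ := by ring

theorem measureReal_exists_not_rel_le [IsFiniteMeasure ν] {f : Y → Y}
    (hf : MeasurePreserving f ν ν) (hD : ∀ i, MeasurableSet (D i)) {P : Y → ι}
    (hP : ∀ y i, y ∈ D i → y ∈ D (P y)) {r : ι → ι → Prop}
    (hr : ∀ i j, ¬ r i j → ν.real (f ⁻¹' D i ∩ D j) ≤ ε) (hε : 0 ≤ ε) :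
    ν.real {y | ∃ j, y ∈ D j ∧ ¬ r (P (f y)) j} ≤
      Fintype.card ι ^ 2 * ε + ν.real (⋃ i, D i)ᶜ := by
  classical
  let bad : Finset (ι × ι) := {x | ¬ r x.1 x.2}
  have hsub : {y | ∃ j, y ∈ D j ∧ ¬ r (P (f y)) j} ⊆
      (⋃ x ∈ bad, f ⁻¹' D x.1 ∩ D x.2) ∪ f ⁻¹' (⋃ i, D i)ᶜ := by
    rintro y ⟨j, hy, hj⟩
    by_cases hfy : ∃ i, f y ∈ D i
    · obtain ⟨i, hi⟩ := hfy
      exact Or.inl (Set.mem_biUnion (x := (P (f y), j)) (by simpa [bad] using hj)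
        ⟨hP _ i hi, hy⟩)
    · exact Or.inr (by simpa using hfy)
  have hbad : ν.real (⋃ x ∈ bad, f ⁻¹' D x.1 ∩ D x.2) ≤ Fintype.card ι ^ 2 * ε := by
    calc _ ≤ ∑ x ∈ bad, ν.real (f ⁻¹' D x.1 ∩ D x.2) := measureReal_biUnion_finset_le _ _
      _ ≤ ∑ _x ∈ bad, ε := Finset.sum_le_sum fun x hx => hr _ _ (Finset.mem_filter.1 hx).2
      _ = bad.card * ε := by simp
      _ ≤ Fintype.card ι ^ 2 * ε := by
        gcongr
        exact_mod_cast bad.card_le_univ.trans_eq (by simp [sq])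
  refine (measureReal_mono hsub).trans ((measureReal_union_le _ _).trans (add_le_add hbad ?_))
  exact (hf.measureReal_preimage (MeasurableSet.iUnion hD).compl.nullMeasurableSet).le

end PatternSets

theorem IsLocal.biUnion_subset {ι A Y : Type*} {W : Finset ι} {E : Set (ι → A)} (hE : IsLocal W E)
    (D : (W → A) → Set Y) (F : Y → ι → A) :
    ⋃ p ∈ W.restrict '' E, D p ⊆
      {y | F y ∈ E} ∪ ⋃ g : W, {y | ∃ p, y ∈ D p ∧ F y g ≠ p g} := by
  simp only [Set.iUnion₂_subset_iff, Set.forall_mem_image]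
  refine fun a ha y hy => or_iff_not_imp_right.2 fun hgood => (hE.mem_iff fun g hg => ?_).1 ha
  by_contra hne
  exact hgood (Set.mem_iUnion.2 ⟨⟨g, hg⟩, _, hy, Ne.symm hne⟩)

theorem measureReal_cylinder_eq_sum {ι A : Type*} [MeasurableSpace A]
    [MeasurableSingletonClass A] {μ : Measure (ι → A)} [IsFiniteMeasure μ] {W : Finset ι}
    (s : Set (W → A)) [Fintype s] :
    μ.real (cylinder W s) = ∑ p ∈ s.toFinset, μ.real (cylinder W {p}) := by
  have := sum_measureReal_preimage_singleton (μ := μ) (f := W.restrict) s.toFinset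
    (fun p _ => W.measurable_restrict (measurableSet_singleton p)) (fun _ _ => measure_ne_top _ _)
  rw [Set.coe_toFinset] at this
  exact this.symm

namespace IsWeaklyContained

variable {Γ A Y : Type*} [Group Γ] [Finite A] [MeasurableSpace A] [MeasurableSingletonClass A]
  {μ : Measure (Γ → A)} {hμ : IsShiftInvariant μ} [MeasurableSpace Y] {ν : Measure Y}
  {S : PMPAction Γ ν}

theorem exists_patternSets (h : IsWeaklyContained (shiftSystem hμ) S) {W : Finset Γ} (hW : 1 ∈ W)
    {ε : ℝ} (hε : 0 < ε) :
    ∃ D : (W → A) → Set Y, (∀ p, MeasurableSet (D p)) ∧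
      (∀ p, |μ.real (cylinder W {p}) - ν.real (D p)| < ε) ∧
      (∀ p q, p ≠ q → ν.real (D p ∩ D q) < ε) ∧
      ∀ (g : W) (p q : W → A), p ⟨1, hW⟩ ≠ q g →
        ν.real (S.act (g : Γ)⁻¹ ⁻¹' D p ∩ D q) < ε := by
  obtain ⟨m, ⟨e⟩⟩ := Finite.exists_equiv_fin (W → A)
  obtain ⟨D, hD, hDε⟩ := h m (fun i => cylinder W {e.symm i})
    (fun i => (measurableSet_singleton _).cylinder W) W ε hε
  replace hDε (g : W) (p q : W → A) : |μ.real (shift (g : Γ)⁻¹ ⁻¹' cylinder W {p} ∩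
      cylinder W {q}) - ν.real (S.act (g : Γ)⁻¹ ⁻¹' D (e p) ∩ D (e q))| < ε := by
    simpa [shiftSystem] using hDε g g.2 (e p) (e q)
  have hDε_empty (g : W) (p q : W → A)
      (hpq : ∀ a : Γ → A, W.restrict a = q → W.restrict (shift (g : Γ)⁻¹ a) ≠ p) :
      ν.real (S.act (g : Γ)⁻¹ ⁻¹' D (e p) ∩ D (e q)) < ε := by
    have hempty : shift (g : Γ)⁻¹ ⁻¹' cylinder W {p} ∩ cylinder W {q} = ∅ :=
      Set.eq_empty_of_forall_notMem fun a ha => hpq a ha.2 ha.1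
    simpa [hempty, abs_lt] using (abs_lt.1 (hDε g p q)).1
  have hshift : (shift (1 : Γ)⁻¹ : (Γ → A) → Γ → A) = id := by rw [inv_one, shift_one]
  have hact (s t : Set Y) : ν.real (S.act (1 : Γ)⁻¹ ⁻¹' s ∩ t) = ν.real (s ∩ t) := by
    refine measureReal_congr (.inter ?_ .rfl)
    rw [inv_one]
    exact S.act_one.fun_comp (· ∈ s)
  refine ⟨fun p => D (e p), fun p => hD _, fun p => ?_, fun p q hpq => ?_, fun g p q hpq => ?_⟩
  · have := hDε ⟨1, hW⟩ p p
    rwa [hact, hshift, Set.preimage_id, Set.inter_self, Set.inter_self] at this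
  · rw [← hact]
    refine hDε_empty ⟨1, hW⟩ p q fun a hq hp => hpq ?_
    rw [← hp, hshift, id, hq]
  · refine hDε_empty g p q fun a hq hp => hpq ?_
    simp [← hq, ← hp, shift]

theorem exists_patternSets_biUnion [IsFiniteMeasure μ] [IsFiniteMeasure ν]
    (h : IsWeaklyContained (shiftSystem hμ) S) {W : Finset Γ} (hW : 1 ∈ W) {ε : ℝ} (hε : 0 < ε) :
    ∃ D : (W → A) → Set Y, (∀ p, MeasurableSet (D p)) ∧
      (∀ s, μ.real (cylinder W s) ≤ ν.real (⋃ p ∈ s, D p) + ε) ∧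
      ∀ (g : W) (p q : W → A), p ⟨1, hW⟩ ≠ q g →
        ν.real (S.act (g : Γ)⁻¹ ⁻¹' D p ∩ D q) ≤ ε := by
  classical
  cases nonempty_fintype (W → A)
  let c : ℝ := Fintype.card (W → A)
  obtain ⟨ε', hε', hεε'⟩ : ∃ ε' > 0, (c ^ 2 + c + 1) * ε' < ε := exists_pos_mul_lt hε _
  obtain ⟨D, hDm, hμD, hinter, hrel⟩ := h.exists_patternSets hW hε'
  refine ⟨D, hDm, fun s => ?_, fun g p q hpq => ?_⟩
  · have := sum_le_measureReal_biUnion_add hDm (fun p q hpq => (hinter p q hpq).le) hε'.le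
      (fun p => sub_le_iff_le_add'.1 (abs_lt.1 (hμD p)).2.le) s.toFinset
    simp only [← measureReal_cylinder_eq_sum, Set.mem_toFinset] at this
    linarith
  · have : 0 ≤ (c ^ 2 + c) * ε' := by positivity
    linarith [hrel g p q hpq]

theorem exists_forall_isLocal_sub_lt [IsProbabilityMeasure μ] [IsProbabilityMeasure ν]
    (h : IsWeaklyContained (shiftSystem hμ) S) {W : Finset Γ} (hW : 1 ∈ W) {η : ℝ} (hη : 0 < η) :
    ∃ φ : Y → A, Measurable φ ∧ ∀ E, IsLocal W E →
      μ.real E - η < ν.real {y | equivariantMap S φ y ∈ E} := by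
  cases nonempty_fintype (W → A)
  let c : ℝ := Fintype.card (W → A)
  obtain ⟨ε, hε, hεη⟩ : ∃ ε > 0, (1 + W.card * (c ^ 2 + 1)) * ε < η := exists_pos_mul_lt hη _
  obtain ⟨D, hDm, hunion, hrel⟩ := h.exists_patternSets_biUnion hW hε
  have hcompl : ν.real (⋃ p, D p)ᶜ ≤ ε := by
    have := hunion Set.univ
    rw [cylinder_univ, probReal_univ, Set.biUnion_univ] at this
    rw [probReal_compl_eq_one_sub (MeasurableSet.iUnion hDm)]
    linarith
  have : Nonempty (W → A) := (nonempty_of_isProbabilityMeasure μ).map W.restrict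
  let P (y : Y) : W → A := Classical.epsilon fun p => y ∈ D p
  have hP (y : Y) (p : W → A) (hy : y ∈ D p) : y ∈ D (P y) :=
    Classical.epsilon_spec (p := (y ∈ D ·)) ⟨p, hy⟩
  let φ (y : Y) : A := P y ⟨1, hW⟩
  have hφ : Measurable φ := (measurable_pi_apply _).comp (measurable_epsilon_mem hDm)
  have hbad : ν.real (⋃ g : W, {y | ∃ p, y ∈ D p ∧ equivariantMap S φ y g ≠ p g}) ≤
      W.card * (c ^ 2 * ε + ε) := by
    calc _ ≤ _ := measureReal_iUnion_fintype_le _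
      _ ≤ ∑ _g : W, (c ^ 2 * ε + ε) := Finset.sum_le_sum fun g _ =>
        (measureReal_exists_not_rel_le (S.measurePreserving _) hDm hP (hrel g) hε.le).trans
          (by gcongr)
      _ = _ := by simp; ring
  refine ⟨φ, hφ, fun E hE => ?_⟩
  have hmono : ν.real (⋃ p ∈ W.restrict '' E, D p) ≤ _ :=
    measureReal_mono (hE.biUnion_subset D (equivariantMap S φ))
  have := hmono.trans (measureReal_union_le _ _)
  have := hunion (W.restrict '' E)
  rw [← hE.eq_cylinder] at this
  linarith

theorem exists_equivariantLaw_mem [TopologicalSpace A] [DiscreteTopology A] [BorelSpace A]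
    [Countable Γ] [IsProbabilityMeasure ν] {μ : ProbabilityMeasure (Γ → A)}
    {hμ : IsShiftInvariant (μ : Measure (Γ → A))} (h : IsWeaklyContained (shiftSystem hμ) S)
    {O : Set (ProbabilityMeasure (Γ → A))} (hO : O ∈ 𝓝 μ) :
    ∃ (φ : Y → A) (hφ : Measurable φ), equivariantLaw S hφ ∈ O := by
  classical
  obtain ⟨W, η, hη, hWO⟩ := exists_local_nhds hO
  obtain ⟨φ, hφ, hlower⟩ := h.exists_forall_isLocal_sub_lt (Finset.mem_insert_self 1 W) hη
  refine ⟨φ, hφ, hWO _ fun E hE => ?_⟩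
  have hlower' {E : Set (Γ → A)} (hE : IsLocal W E) : (μ : Measure (Γ → A)).real E - η <
      (equivariantLaw S hφ : Measure (Γ → A)).real E :=
    (hlower E (hE.mono (Finset.subset_insert 1 W))).trans_eq
      (map_measureReal_apply (measurable_equivariantMap S hφ) hE.measurableSet).symm
  have hcompl := hlower' hE.compl
  rw [probReal_compl_eq_one_sub hE.measurableSet, probReal_compl_eq_one_sub hE.measurableSet]
    at hcompl
  exact abs_lt.2 ⟨by linarith [hlower' hE], by linarith⟩

end IsWeaklyContained

theorem exists_measureReal_prodMk_preimage_le {X Y : Type*} [MeasurableSpace X] {μ : Measure X}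
    [IsProbabilityMeasure μ] [MeasurableSpace Y] {ν : Measure Y} [IsFiniteMeasure ν]
    {s : Set (X × Y)} (hs : MeasurableSet s) :
    ∃ x, ν.real (Prod.mk x ⁻¹' s) ≤ (μ.prod ν).real s := by
  obtain ⟨x, hx⟩ := exists_le_lintegral (μ := μ)
    (measurable_measure_prodMk_left (ν := ν) hs).aemeasurable
  rw [← Measure.prod_apply hs] at hx
  exact ⟨x, ENNReal.toReal_mono (measure_ne_top _ _) hx⟩

theorem IsShiftInvariant.ae_eq_const {Γ A : Type*} [Group Γ] [Countable Γ] [MeasurableSpace A]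
    {μ : Measure (Γ → A)} (hμ : IsShiftInvariant μ) {a : A} (h : ∀ᵐ x ∂μ, x 1 = a) :
    ∀ᵐ x ∂μ, x = fun _ => a := by
  have hshift : ∀ᵐ x ∂μ, ∀ g, shift g⁻¹ x 1 = a := ae_all_iff.2 fun g =>
    ((shiftSystem hμ).measurePreserving g⁻¹).quasiMeasurePreserving.ae h
  filter_upwards [hshift] with x hx
  exact funext fun g => by simpa [shift] using hx g

namespace HasTotallyShatteredMicrostates

variable {Γ A K : Type*} [Group Γ] [Countable Γ] {V : ℕ → Type*} [∀ n, Fintype (V n)]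
  [∀ n, Nonempty (V n)] {σ : ∀ n, Γ →* Equiv.Perm (V n)} [Finite A] [TopologicalSpace A]
  [DiscreteTopology A] [MeasurableSpace A] [BorelSpace A] {μ : ProbabilityMeasure (Γ → A)}
  {hμ : IsShiftInvariant (μ : Measure (Γ → A))} [MeasurableSpace K] {κ : Measure K}
  [IsProbabilityMeasure κ]

theorem exists_measureReal_ne_lt (h : HasTotallyShatteredMicrostates (fun n => σ n) μ)
    (hσ : IsSoficApproximation fun n => σ n)
    (hcard : Tendsto (fun n => Fintype.card (V n)) atTop atTop)
    (hweak : IsWeaklyContained (shiftSystem hμ) (bernoulliShift Γ κ)) {ε : ℝ} (hε : 0 < ε) :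
    ∃ a, (μ : Measure (Γ → A)).real {x | x 1 ≠ a} < ε := by
  obtain ⟨O, hO, hlt⟩ := h.exists_nhds_forall_measureReal_ne_lt hσ hcard (half_pos hε)
  obtain ⟨φ, hφ, hlawO, hlaw⟩ := hweak.exists_equivariantLaw_mem
    (inter_mem hO (eventually_nhds_forall_isLocal μ {1} (half_pos hε)))
  have hφ' : Measurable (φ ∘ (Prod.snd : (Γ → A) × (Γ → K) → Γ → K)) := hφ.comp measurable_snd
  have hlaw_eq : equivariantLaw ((shiftSystem hμ).prod (bernoulliShift Γ κ)) hφ' =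
      equivariantLaw (bernoulliShift Γ κ) hφ :=
    Subtype.ext (isFactorMap_snd.map_equivariantMap_comp hφ)
  have hresample := hlt _ _ (shiftSystem hμ) (h.1.allModels hμ) K κ _ hφ' (hlaw_eq ▸ hlawO)
  have hne : MeasurableSet {p : (Γ → K) × (Γ → K) | φ p.1 ≠ φ p.2} :=
    (measurableSet_eq_fun (hφ.comp measurable_fst) (hφ.comp measurable_snd)).compl
  obtain ⟨z, hz⟩ := exists_measureReal_prodMk_preimage_le (μ := bernoulliMeasure Γ κ)
    (ν := bernoulliMeasure Γ κ) hne
  rw [← (measurePreserving_snd (μ := (μ : Measure (Γ → A)))).measureReal_preimage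
    hne.nullMeasurableSet] at hz
  have hE : IsLocal {1} {x : Γ → A | x 1 ≠ φ z} :=
    fun a b hab => congrArg (· ≠ φ z) (hab 1 (Finset.mem_coe.2 (Finset.mem_singleton_self 1)))
  have hlaw_real : (equivariantLaw (bernoulliShift Γ κ) hφ : Measure (Γ → A)).real
      {x | x 1 ≠ φ z} = (bernoulliMeasure Γ κ).real (Prod.mk z ⁻¹' {p | φ p.1 ≠ φ p.2}) := by
    refine (map_measureReal_apply (measurable_equivariantMap _ hφ) hE.measurableSet).trans ?_
    simp [equivariantMap, bernoulliShift, shiftSystem, shift_one, ne_comm]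
  refine ⟨φ z, ?_⟩
  have := hz.trans_lt hresample
  linarith [(abs_lt.1 (hlaw _ hE)).1]

theorem exists_eq_dirac_of_isWeaklyContained
    (h : HasTotallyShatteredMicrostates (fun n => σ n) μ)
    (hσ : IsSoficApproximation fun n => σ n)
    (hcard : Tendsto (fun n => Fintype.card (V n)) atTop atTop)
    (hweak : IsWeaklyContained (shiftSystem hμ) (bernoulliShift Γ κ)) :
    ∃ a, (μ : Measure (Γ → A)) = Measure.dirac fun _ => a := by
  have : Nonempty A :=
    (nonempty_of_isProbabilityMeasure (μ : Measure (Γ → A))).map (Function.eval 1)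
  obtain ⟨a, ha⟩ := Finite.exists_min fun a => (μ : Measure (Γ → A)).real {x | x 1 ≠ a}
  have hzero : (μ : Measure (Γ → A)).real {x | x 1 ≠ a} = 0 := by
    refine le_antisymm (not_lt.1 fun hpos => ?_) measureReal_nonneg
    obtain ⟨b, hb⟩ := h.exists_measureReal_ne_lt hσ hcard hweak hpos
    exact (ha b).not_gt hb
  exact ⟨a, eq_dirac_of_ae_eq (hμ.ae_eq_const ((measureReal_eq_zero_iff (by finiteness)).1 hzero))⟩

end HasTotallyShatteredMicrostates

end SoficShift

theorem mainTheorem8_general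
    {Γ : Type uΓ} [Group Γ] [Countable Γ]
    {V : ℕ → Type uV} [∀ n, Fintype (V n)] [∀ n, Nonempty (V n)]
    (σ : ∀ n, Γ →* Equiv.Perm (V n))
    (hσ : IsSoficApproximation (fun n => ⇑(σ n)))
    (hV : Finite Γ → Tendsto (fun n => Fintype.card (V n)) atTop atTop)
    {A : Type uA} [Finite A] [TopologicalSpace A] [DiscreteTopology A] [MeasurableSpace A]
    [BorelSpace A]
    (μ : ProbabilityMeasure (Γ → A)) (hμ : IsShiftInvariant (μ : Measure (Γ → A)))
    (hshatt : HasTotallyShatteredMicrostates (fun n => ⇑(σ n)) μ) :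
    (∀ ε : ℝ, 0 < ε → ∃ O ∈ 𝓝 μ,
      ∀ (Y : Type uB) [MeasurableSpace Y] (θ : Measure Y) [IsProbabilityMeasure θ]
        (S : PMPAction Γ θ), SystemHasMicrostates (fun n => ⇑(σ n)) S →
      ∀ (K : Type uK) [MeasurableSpace K]
        (κ : Measure K) [IsProbabilityMeasure κ]
        (φ : Y × (Γ → K) → A) (hφ : Measurable φ),
        equivariantLaw (S.prod (bernoulliShift Γ κ)) hφ ∈ O →
        (θ.prod ((bernoulliMeasure Γ κ).prod (bernoulliMeasure Γ κ))).real
          {p | φ (p.1, p.2.1) ≠ φ (p.1, p.2.2)} < ε) ∧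
    (∀ (Y : Type uY) [MeasurableSpace Y]
        (θ : Measure Y) [IsProbabilityMeasure θ] (S : PMPAction Γ θ),
        SystemHasMicrostates (fun n => ⇑(σ n)) S →
      ∀ (K : Type uK) [MeasurableSpace K]
        (κ : Measure K) [IsProbabilityMeasure κ]
        (Φ : Y × (Γ → K) → Γ → A),
        IsFactorMap (S.prod (bernoulliShift Γ κ)) (shiftSystem hμ) Φ →
        ∃ Ψ : Y → Γ → A, IsFactorMap S (shiftSystem hμ) Ψ ∧
          ∀ᵐ p ∂(θ.prod (bernoulliMeasure Γ κ)), Φ p = Ψ p.1) ∧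
    (∀ (K : Type uK) [MeasurableSpace K]
        (κ : Measure K) [IsProbabilityMeasure κ],
        IsDirectFactor.{uY} (bernoulliShift Γ κ) (shiftSystem hμ) →
        ∃ k : K, κ = Measure.dirac k) ∧
    (∀ (K : Type uK) [MeasurableSpace K]
        (κ : Measure K) [IsProbabilityMeasure κ],
        IsWeaklyContained (shiftSystem hμ) (bernoulliShift Γ κ) →
        ∃ a : A, (μ : Measure (Γ → A)) = Measure.dirac (fun _ => a)) := by
  have hcard := tendsto_card_atTop hσ hV
  refine ⟨fun ε hε => ?_, ?_, ?_, ?_⟩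
  · obtain ⟨O, hO, hlt⟩ := hshatt.exists_nhds_forall_measureReal_ne_lt hσ hcard hε
    exact ⟨O, hO, fun Y _ θ _ S hS => hlt Y θ S (systemHasMicrostates_iff_allModels.1 hS)⟩
  · intro Y _ θ _ S hS K _ κ _ Φ hΦ
    exact hshatt.exists_factorization hσ hcard (systemHasMicrostates_iff_allModels.1 hS) hΦ
  · intro K _ κ _ hdirect
    exact hshatt.exists_eq_dirac_of_isDirectFactor hσ hcard hdirect
  · intro K _ κ _ hweak
    exact hshatt.exists_eq_dirac_of_isWeaklyContained hσ hcard hweak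

theorem mainTheorem8
    {Γ : Type uΓ} [Group Γ] [Countable Γ]
    {V : ℕ → Type uV} [∀ n, Fintype (V n)] [∀ n, Nonempty (V n)]
    (σ : ∀ n, Γ →* Equiv.Perm (V n))
    (hσ : IsSoficApproximation (fun n => ⇑(σ n)))
    (hV : Finite Γ → Tendsto (fun n => Fintype.card (V n)) atTop atTop)
    {A : Type uA} [Finite A] [TopologicalSpace A] [DiscreteTopology A] [MeasurableSpace A]
    [BorelSpace A]
    (μ : ProbabilityMeasure (Γ → A)) (hμ : IsShiftInvariant (μ : Measure (Γ → A)))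
    (hshatt : HasTotallyShatteredMicrostates (fun n => ⇑(σ n)) μ) :
    -- near-factor maps from a product with a Bernoulli shift nearly ignore the Bernoulli coordinate
    (∀ ε : ℝ, 0 < ε → ∃ O ∈ 𝓝 μ,
      ∀ (B : Type uB) [Finite B] [TopologicalSpace B] [DiscreteTopology B] [MeasurableSpace B]
        [BorelSpace B] (ν : ProbabilityMeasure (Γ → B))
        (hν : IsShiftInvariant (ν : Measure (Γ → B))),
        HasMicrostates (fun n => ⇑(σ n)) ν →
      ∀ (K : Type uK) [MeasurableSpace K] [StandardBorelSpace K]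
        (κ : Measure K) [IsProbabilityMeasure κ]
        (φ : (Γ → B) × (Γ → K) → A) (hφ : Measurable φ),
        equivariantLaw ((shiftSystem hν).prod (bernoulliShift Γ κ)) hφ ∈ O →
        ((ν : Measure (Γ → B)).prod ((bernoulliMeasure Γ κ).prod (bernoulliMeasure Γ κ))).real
          {p | φ (p.1, p.2.1) ≠ φ (p.1, p.2.2)} < ε) ∧
    -- factor maps from a product with a Bernoulli shift factorize through the other coordinate
    (∀ (Y : Type uY) [MeasurableSpace Y] [StandardBorelSpace Y]
        (θ : Measure Y) [IsProbabilityMeasure θ] (S : PMPAction Γ θ),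
        SystemHasMicrostates (fun n => ⇑(σ n)) S →
      ∀ (K : Type uK) [MeasurableSpace K] [StandardBorelSpace K]
        (κ : Measure K) [IsProbabilityMeasure κ]
        (Φ : Y × (Γ → K) → Γ → A),
        IsFactorMap (S.prod (bernoulliShift Γ κ)) (shiftSystem hμ) Φ →
        ∃ Ψ : Y → Γ → A, IsFactorMap S (shiftSystem hμ) Ψ ∧
          ∀ᵐ p ∂(θ.prod (bernoulliMeasure Γ κ)), Φ p = Ψ p.1) ∧
    -- every direct Bernoulli factor is trivial
    (∀ (K : Type uK) [MeasurableSpace K] [StandardBorelSpace K]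
        (κ : Measure K) [IsProbabilityMeasure κ],
        IsDirectFactor.{uY} (bernoulliShift Γ κ) (shiftSystem hμ) →
        ∃ k : K, κ = Measure.dirac k) ∧
    -- the system is not weakly contained in a Bernoulli shift unless it is trivial
    (∀ (K : Type uK) [MeasurableSpace K] [StandardBorelSpace K]
        (κ : Measure K) [IsProbabilityMeasure κ],
        IsWeaklyContained (shiftSystem hμ) (bernoulliShift Γ κ) →
        ∃ a : A, (μ : Measure (Γ → A)) = Measure.dirac (fun _ => a)) := by
  obtain ⟨h₀, h₁, h₂, h₃⟩ := mainTheorem8_general σ hσ hV μ hμ hshatt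
  exact ⟨fun ε hε => (h₀ ε hε).imp fun O hO => ⟨hO.1, fun B _ _ _ _ _ ν hν hmicro K _ _ =>
      hO.2 (Γ → B) ν (shiftSystem hν)
        (systemHasMicrostates_iff_allModels.2 (hmicro.allModels hν)) K⟩,
    fun Y _ _ θ _ S hS K _ _ => h₁ Y θ S hS K, fun K _ _ => h₂ K, fun K _ _ => h₃ K⟩
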